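/- **Setting.** For $f,g\in L^2(\mathbb R^d,\mathbb R^m)$ let $\langle f,g\rangle_*=\int f(x)g(x)^T\,dx\in\mathbb R^{m\times m}$. A family $(U_i)$ in $L^2(\mathbb R^d,\mathbb R^m)$ is an *orthonormal basis* of a closed subspace $V$ if $\langle U_i,U_{i'}\rangle_*=\delta_{i,i'}I_m$, $QU_i\in V$ for every $m\times m$ matrix $Q$ and every $i$, and every $f\in V$ has a unique expansion $f=\sum_i Q_iU_i$ (converging unconditionally in $L^2$) with a square-summable family of $m\times m$ matrices $Q_i$. A *VMRA* of $L^2(\mathbb R^d,\mathbb R^m)$ with dilation matrix $A$ (integer entries, all eigenvalues of modulus $>1$) and scaling functions $\Phi^1,\dots,\Phi^s$ is a sequence of closed subspaces $(V_j)_{j\in\mathbb Z}$ with $V_j\subset V_{j+1}$; $\bigcap_jV_j=\{0\}$; $\bigcup_jV_j$ dense; $h\in V_j\iff h(A\,\cdot)\in V_{j+1}$ for all $j\in\mathbb Z$; $h\in V_j\iff h(\cdot-k)\in V_j$ for all $j\ge 0$, $k\in\mathbb Z^d$; and such that $\{\Phi^l(\cdot-k):1\le l\le s,\ k\in\mathbb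 Z^d\}$ is an orthonormal basis of $V_0$. A *wavelet basis of $L^2(\mathbb R^d,\mathbb R^m)$ respecting the VMRA*, with these scaling functions and with mother wavelets $\Psi^1,\dots,\Psi^t$, means that moreover $\{\Psi^q(\cdot-k)\}_{q,k}$ is an orthonormal basis of $V_1\ominus V_0$ and that $\{\Phi^l(\cdot-k)\}_{l,k}\cup\{|\det A|^{j/2}\Psi^q(A^j\cdot-k)\}_{q,\,j\ge0,\,k}$ is an orthonormal basis of $L^2(\mathbb R^d,\mathbb R^m)$. **Theorem.** Let $\phi,\psi:\mathbb R\to\mathbb R$ be the scaling function and the mother wavelet of an orthonormal wavelet basis of $L^2(\mathbb R)$ that comes from a dyadic MRA (i.e. there is an MRA $(V_j)_{j\in\mathbb Z}$ of $L^2(\mathbb R)$ with dilation $2$ such that the integer translates of $\phi$ are an orthonormal basis of $V_0$ and those of $\psi$ are one of $V_1\ominus V_0$). Let $d,m\ge1$. (a) There is a wavelet basis of $L^2(\mathbb R^d,\mathbb R^m)$ respecting a VMRA with dilation matrix $2I_d$, with a single scaling function $\Phi$ and $2^d-1$ mother wavelets $\Psi^\epsilon$, $\epsilon\in\{0,1\}^d\setminus\{0\}$.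 It is separable: every component of $\Phi$ and of each $\Psi^\epsilon$ is a product $g_1(x_1)\cdots g_d(x_d)$ in which every $g_i$ is a finite linear combination of functions $\phi(a\,\cdot-b)$, $\psi(a\,\cdot-b)$ with $a>0$, $b\in\mathbb R$. It inherits the properties (P) below. (b) There are functions $u_1,\dots,u_m$, each a finite linear combination of dilated translates of $\phi$ and $\psi$, and $w_1,\dots,w_m$, each a finite linear combination of dilated translates of $\psi$, such that $u=(u_1,\dots,u_m)^T$ and $w=(w_1,\dots,w_m)^T$ are the scaling function and the mother wavelet of a wavelet basis of $L^2(\mathbb R,\mathbb R^m)$ respecting a VMRA with dilation $2$ and inheriting (P), and such that the following holds for every partition of $\{1,\dots,m\}^d$ into $m^{d-1}$ blocks $A_l=\{\alpha^l_1,\dots,\alpha^l_m\}$ of $m$ (enumerated) elements. For $\epsilon\in\{0,1\}^d$ and $1\le l\le m^{d-1}$ put $$\Psi^{\epsilon,l}(x)=\Big(\prod_{i=1}^d g^{\epsilon_i}_{\alpha^l_{r,i}}(x_i)\Big)_{r=1,\dots,m},\qquad g^0_s=u_s,\quad g^1_s=w_s .$$ Then the scaling functions $\Psi^{0,l}$ and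 the mother wavelets $\Psi^{\epsilon,l}$, $\epsilon\ne0$, form a wavelet basis of $L^2(\mathbb R^d,\mathbb R^m)$ respecting a VMRA with dilation matrix $2I_d$, and it inherits (P). (P) *Regularity:* for $n\in\mathbb N\cup\{\infty\}$, if $\phi,\psi\in C^n$ then all the scaling functions and mother wavelets are $C^n$. *Compact support:* if $\phi$ and $\psi$ are compactly supported, then so are all the scaling functions and mother wavelets. *Vanishing moments:* for $N\in\mathbb N$, if $x^n\phi$ and $x^n\psi$ are integrable and $\int x^n\psi(x)\,dx=0$ for all $0\le n<N$, then for every mother wavelet $\Psi$ and every $\beta\in\mathbb N^d$ with $|\beta|<N$, $x^\beta\Psi$ is integrable and $\int x^\beta\Psi(x)\,dx=0$. -/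

import Mathlib

open MeasureTheory
open scoped ENNReal Matrix

noncomputable section

namespace VecWavelet

/-! ### The space of square integrable vector fields, the matrix-valued product, bases -/

/-- `ℝⁿ` with its Euclidean norm and Lebesgue measure. -/
abbrev E (n : ℕ) : Type := EuclideanSpace ℝ (Fin n)

/-- The Hilbert space `L²(ℝᵈ, ℝᵐ)`. -/
abbrev L2 (d m : ℕ) : Type := Lp (E m) 2 (volume : Measure (E d))

/-- The Hilbert space `L²(ℝ)`. -/
abbrev L2R : Type := Lp ℝ 2 (volume : Measure ℝ)

/-- The `*`-product `⟨f, g⟩_* = ∫ f(x) g(x)ᵀ dx`, an `m × m` matrix. -/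
def starProd {d m : ℕ} (f g : E d → E m) : Matrix (Fin m) (Fin m) ℝ :=
  Matrix.of fun a b => ∫ x, f x a * g x b

/-- The function `x ↦ Q f(x)` as an element of `L²(ℝᵈ, ℝᵐ)`. -/
def matMul {d m : ℕ} (Q : Matrix (Fin m) (Fin m) ℝ) (f : L2 d m) : L2 d m :=
  (Matrix.toEuclideanCLM (n := Fin m) (𝕜 := ℝ) Q).compLp f

/-- The family `U` of vector fields is an orthonormal basis, in the matrix-valued sense, of the
subspace `V` of `L²(ℝᵈ, ℝᵐ)`: it is orthonormal for the `*`-product, its matrix multiples lie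
in `V`, and every element of `V` has a unique expansion `∑ Q_i U_i` with a square summable family
of matrix coefficients. -/
structure IsMatrixBasis {d m : ℕ} {ι : Type} (U : ι → E d → E m)
    (V : Submodule ℝ (L2 d m)) : Prop where
  memLp : ∀ i, MemLp (U i) 2 volume
  star_self : ∀ i, starProd (U i) (U i) = 1
  star_ne : ∀ i j, i ≠ j → starProd (U i) (U j) = 0
  mem : ∀ (Q : Matrix (Fin m) (Fin m) ℝ) (i : ι), matMul Q ((memLp i).toLp (U i)) ∈ V
  expansion : ∀ f ∈ V, ∃! Q : ι → Matrix (Fin m) (Fin m) ℝ,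
    (Summable fun i => ∑ a, ∑ b, (Q i a b) ^ 2) ∧
      HasSum (fun i => matMul (Q i) ((memLp i).toLp (U i))) f

/-! ### Vector-valued multiresolution analyses and wavelet bases -/

/-- An integer vector as a point of `ℝᵈ`. -/
def intVec {d : ℕ} (k : Fin d → ℤ) : E d := WithLp.toLp 2 fun i => (k i : ℝ)

/-- The linear map of `ℝᵈ` given by an integer matrix. -/
def dil {d : ℕ} (A : Matrix (Fin d) (Fin d) ℤ) (x : E d) : E d :=
  WithLp.toLp 2 ((A.map (Int.cast : ℤ → ℝ)) *ᵥ x.ofLp)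

/-- The integer matrix `A` is expanding: all its complex eigenvalues have modulus `> 1`. -/
def IsDilation {d : ℕ} (A : Matrix (Fin d) (Fin d) ℤ) : Prop :=
  ∀ μ ∈ spectrum ℂ (A.map (Int.cast : ℤ → ℂ)), 1 < ‖μ‖

/-- The integer translate `F(· - k)`. -/
def translate {d m : ℕ} (F : E d → E m) (k : Fin d → ℤ) : E d → E m :=
  fun x => F (x - intVec k)

/-- The normalized dilated translate `|det A|^{j/2} F(A^j · - k)`. -/
def atom {d m : ℕ} (A : Matrix (Fin d) (Fin d) ℤ) (F : E d → E m) (j : ℕ) (k : Fin d → ℤ) :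
    E d → E m :=
  fun x => (Real.sqrt |(A.det : ℝ)|) ^ j • F (dil (A ^ j) x - intVec k)

/-- `V` is a vector-valued multiresolution analysis of `L²(ℝᵈ, ℝᵐ)` with dilation matrix `A` and
with the (finitely many) vector-valued scaling functions `Φ i`. For a one-element index type this
is a VMRA with one scaling function. -/
structure IsVMRA {d m : ℕ} {ι : Type} (A : Matrix (Fin d) (Fin d) ℤ)
    (V : ℤ → Submodule ℝ (L2 d m)) (Φ : ι → E d → E m) : Prop where
  isDilation : IsDilation A
  isClosed : ∀ j, IsClosed (V j : Set (L2 d m))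
  le_succ : ∀ j, V j ≤ V (j + 1)
  iInf_eq : ⨅ j, V j = ⊥
  dense : Dense (⋃ j, (V j : Set (L2 d m)))
  dilation : ∀ (j : ℤ) (f g : L2 d m), (g =ᵐ[volume] fun x => f (dil A x)) →
    (f ∈ V j ↔ g ∈ V (j + 1))
  translation : ∀ (j : ℤ) (k : Fin d → ℤ) (f g : L2 d m), 0 ≤ j →
    (g =ᵐ[volume] fun x => f (x - intVec k)) → (f ∈ V j ↔ g ∈ V j)
  basis : IsMatrixBasis (fun p : ι × (Fin d → ℤ) => translate (Φ p.1) p.2) (V 0)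

/-- The scaling functions `Φ i` and the mother wavelets `Ψ q` give an orthonormal vector-valued
wavelet basis of `L²(ℝᵈ, ℝᵐ)` that respects a VMRA: the `Φ i` are the scaling functions of a VMRA
`V`, the integer translates of the `Ψ q` form an orthonormal basis of `V₁ ⊖ V₀`, and the translates
of the `Φ i` with the dilated translates of the `Ψ q` at the scales `j = 0, 1, 2, …` form an
orthonormal basis of `L²(ℝᵈ, ℝᵐ)`. -/
def IsWaveletBasis {d m : ℕ} {ι κ : Type} (A : Matrix (Fin d) (Fin d) ℤ)
    (Φ : ι → E d → E m) (Ψ : κ → E d → E m) : Prop :=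
  ∃ V : ℤ → Submodule ℝ (L2 d m),
    IsVMRA A V Φ ∧
    IsMatrixBasis (fun p : κ × (Fin d → ℤ) => translate (Ψ p.1) p.2) ((V 0)ᗮ ⊓ V 1) ∧
    IsMatrixBasis
      (Sum.elim (fun p : ι × (Fin d → ℤ) => translate (Φ p.1) p.2)
        (fun p : κ × ℕ × (Fin d → ℤ) => atom A (Ψ p.1) p.2.1 p.2.2))
      (⊤ : Submodule ℝ (L2 d m))

/-- The dyadic dilation matrix `2 I`. -/
def dyadic (d : ℕ) : Matrix (Fin d) (Fin d) ℤ :=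
  Matrix.diagonal fun _ => 2

/-! ### Scalar wavelets of `L²(ℝ)` that come from a multiresolution analysis -/

/-- The integer translates of `f` are an orthonormal basis (in the usual Hilbert space sense) of
the subspace `V` of `L²(ℝ)`. -/
structure IsTranslateBasis (f : ℝ → ℝ) (V : Submodule ℝ L2R) : Prop where
  memLp : ∀ k : ℤ, MemLp (fun x => f (x - k)) 2 volume
  orthonormal : Orthonormal ℝ fun k : ℤ => (memLp k).toLp (fun x => f (x - k))
  closure_span : (Submodule.span ℝ
    (Set.range fun k : ℤ => (memLp k).toLp (fun x => f (x - k)))).topologicalClosure = V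

/-- `V` is a (dyadic, orthonormal) multiresolution analysis of `L²(ℝ)` with scaling function
`φ`. -/
structure IsScalarMRA (V : ℤ → Submodule ℝ L2R) (φ : ℝ → ℝ) : Prop where
  isClosed : ∀ j, IsClosed (V j : Set L2R)
  le_succ : ∀ j, V j ≤ V (j + 1)
  iInf_eq : ⨅ j, V j = ⊥
  dense : Dense (⋃ j, (V j : Set L2R))
  dilation : ∀ (j : ℤ) (f g : L2R), (g =ᵐ[volume] fun x => f (2 * x)) →
    (f ∈ V j ↔ g ∈ V (j + 1))
  basis : IsTranslateBasis φ (V 0)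

/-- `φ` and `ψ` are the scaling function and the mother wavelet of a wavelet basis of `L²(ℝ)` that
comes from a multiresolution analysis. -/
def IsScalarWavelet (φ ψ : ℝ → ℝ) : Prop :=
  ∃ V : ℤ → Submodule ℝ L2R, IsScalarMRA V φ ∧ IsTranslateBasis ψ ((V 0)ᗮ ⊓ V 1)

/-! ### Separable vector fields built from univariate functions -/

/-- The functions that are finite linear combinations of dilated translates `g(a · - b)`, `a > 0`,
of functions `g` in `S`. -/
def dilateSpan (S : Set (ℝ → ℝ)) : Submodule ℝ (ℝ → ℝ) :=
  Submodule.span ℝ {h | ∃ g ∈ S, ∃ a b : ℝ, 0 < a ∧ h = fun x => g (a * x - b)}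

/-- Every component of `F` is a product `g₁(x₁) ⋯ g_d(x_d)`, where each `g_i` is a finite linear
combination of dilated translates of `φ` and `ψ`. -/
def IsSeparable {d m : ℕ} (φ ψ : ℝ → ℝ) (F : E d → E m) : Prop :=
  ∀ r : Fin m, ∃ g : Fin d → ℝ → ℝ, (∀ i, g i ∈ dilateSpan {φ, ψ}) ∧
    ∀ x, F x r = ∏ i, g i (x i)

/-- The vector-valued function `(u₁, …, u_m)ᵀ` of one real variable. -/
def vec {m : ℕ} (u : Fin m → ℝ → ℝ) : E 1 → E m :=
  fun x => WithLp.toLp 2 fun r => u r (x 0)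

/-- The tensor products of the `u`s and `w`s, regrouped `m` at a time. The bijection `e` encodes a
partition of `{1, …, m}ᵈ` into `m^{d-1}` blocks with `m` (enumerated) elements `e (l, 1), …,
e (l, m)`. The `r`-th component of the field is the product over `i` of the univariate functions
with index `e (l, r) i`, taken among the `w`s where `ε i` is true and among the `u`s elsewhere. -/
def regroup {d m : ℕ} (u w : Fin m → ℝ → ℝ)
    (e : Fin (m ^ (d - 1)) × Fin m ≃ (Fin d → Fin m))
    (ε : Fin d → Bool) (l : Fin (m ^ (d - 1))) : E d → E m :=
  fun x => WithLp.toLp 2 fun r =>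
    ∏ i, (if ε i = true then w (e (l, r) i) (x i) else u (e (l, r) i) (x i))

/-- The types of mother wavelets: the nonzero vectors of `{0, 1}ᵈ`. -/
abbrev NonzeroSign (d : ℕ) : Type := {ε : Fin d → Bool // ε ≠ fun _ => false}

/-! ### The inherited properties -/

/-- `N` vanishing moments of a scalar function (the moments being absolutely convergent). -/
def VanishingMoments (N : ℕ) (f : ℝ → ℝ) : Prop :=
  ∀ n < N, Integrable (fun x => x ^ n * f x) volume ∧ ∫ x, x ^ n * f x = 0

/-- `N` vanishing moments of a vector field: all moments of total degree `< N` are (absolutely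
convergent and) zero. -/
def VanishingMomentsVec {d m : ℕ} (N : ℕ) (F : E d → E m) : Prop :=
  ∀ β : Fin d → ℕ, ∑ i, β i < N →
    Integrable (fun x : E d => (∏ i, x i ^ β i) • F x) volume ∧
      ∫ x : E d, (∏ i, x i ^ β i) • F x = 0

/-- The scaling functions `Φ i` and mother wavelets `Ψ q` inherit from `φ` and `ψ` the smoothness
of class `C^n` (`n ≤ ∞`), the compactness of the support, and vanishing moments. -/
structure Inherits {d m : ℕ} {ι κ : Type} (φ ψ : ℝ → ℝ) (Φ : ι → E d → E m)
    (Ψ : κ → E d → E m) : Prop where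
  regularity : ∀ n : ℕ∞, ContDiff ℝ n φ → ContDiff ℝ n ψ →
    (∀ i, ContDiff ℝ n (Φ i)) ∧ ∀ q, ContDiff ℝ n (Ψ q)
  compactSupport : HasCompactSupport φ → HasCompactSupport ψ →
    (∀ i, HasCompactSupport (Φ i)) ∧ ∀ q, HasCompactSupport (Ψ q)
  vanishingMoments : ∀ N : ℕ, (∀ n < N, Integrable (fun x => x ^ n * φ x) volume) →
    VanishingMoments N ψ → ∀ q, VanishingMomentsVec N (Ψ q)

end VecWavelet

end

open MeasureTheory Filter Topology
open scoped ENNReal Matrix InnerProductSpace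

noncomputable section

namespace VecWavelet

/-! ### Closed spans in Hilbert spaces -/

section ClosedSpan

variable {G : Type*} [NormedAddCommGroup G] [InnerProductSpace ℝ G]

/-! The matrix-valued theory reduces to scalar orthonormal bases. If `E_ab` denotes the matrix
units, the multiples `E_ab U_i` are the fields whose only nonzero component, in position `a`, is the
`b`-th component of `U_i`. When these fields form an orthonormal family with closed span `V`, the
`U_i` form a matrix basis of `V`: the entries of `⟨U_i, U_j⟩_*` are scalar inner products, and a
matrix coefficient is a packet of `m²` scalar coefficients (`isMatrixBasis_of_orthonormal`). Hence
any grouping of orthonormal scalar functions into `m`-tuples gives orthonormal vector fields,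
whatever the grouping. It remains to have scalar bases whose number of scaling functions is
divisible by `m`.

Such bases come from the unitary dilation `D_n` by an integer `n`. It commutes with the dilation by
`2` and turns translation by `nk` into translation by `k`, so the spaces `D_n V_j` again form an
MRA. Writing an integer as `nk + r` with `0 ≤ r < n`, the image of the basis `φ(· - (nk + r))`
consists of the integer translates of the `n` functions `√n φ(n · - r)`; the same holds for `ψ`
(`exists_isMultiMRA_packet`).

Using `n_i` functions in coordinate `i`, tensor products give nested spaces in `L²(ℝᵈ, ℝᵐ)`. Density
and trivial intersection follow from convergence of the univariate projections and from totality of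
pure tensors (`dense_iUnion_tensorSpan`, `IsTensor.iInf_tensorSpan`, `isTotal_tensor`). The tensor
basis of the space of scale `1` is labelled by types in `{0,1}ᵈ`: type `0` spans scale `0`, so the
nonzero types span the orthogonal difference. Dilations by `2^j` carry this to all levels `j ≥ 0`
(`isWaveletBasis_tensorGroup`).

There are `∏ n_i` scaling products. Sizes `(m, 1, …, 1)` leave exactly one block of `m`, which is
(a); sizes `(m, …, m)` leave `m^(d-1)` blocks, which is (b). Smoothness and support pass to
products; moments vanish because every wavelet has a factor built from `ψ`. -/

/-- The closed linear span of a set of vectors. -/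
def closedSpan (s : Set G) : Submodule ℝ G := (Submodule.span ℝ s).topologicalClosure

theorem isClosed_closedSpan (s : Set G) : IsClosed (closedSpan s : Set G) :=
  Submodule.isClosed_topologicalClosure _

theorem subset_closedSpan (s : Set G) : s ⊆ closedSpan s :=
  fun _ hx => Submodule.le_topologicalClosure _ (Submodule.subset_span hx)

theorem closedSpan_le {s : Set G} {K : Submodule ℝ G} (hK : IsClosed (K : Set G)) (h : s ⊆ K) :
    closedSpan s ≤ K :=
  Submodule.topologicalClosure_minimal _ (Submodule.span_le.2 h) hK

theorem mem_orthogonal_closedSpan {s : Set G} {f : G} :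
    f ∈ (closedSpan s)ᗮ ↔ ∀ g ∈ s, ⟪g, f⟫_ℝ = 0 := by
  rw [closedSpan, Submodule.orthogonal_closure]
  refine ⟨fun h g hg => h g (Submodule.subset_span hg), fun h => ?_⟩
  have : Submodule.span ℝ s ≤ (ℝ ∙ f)ᗮ :=
    Submodule.span_le.2 fun g hg => Submodule.mem_orthogonal_singleton_iff_inner_left.2 (h g hg)
  exact fun u hu => Submodule.mem_orthogonal_singleton_iff_inner_left.1 (this hu)

theorem tendsto_starProjection_self {V : ℤ → Submodule ℝ G}
    [∀ j, (V j).HasOrthogonalProjection] (hV : Monotone V)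
    (hd : Dense (⋃ j, (V j : Set G))) (f : G) :
    Tendsto (fun j => (V j).starProjection f) atTop (𝓝 f) := by
  refine Submodule.starProjection_tendsto_self V hV f ?_
  rw [top_le_iff, ← Submodule.dense_iff_topologicalClosure_eq_top,
    Submodule.coe_iSup_of_directed V hV.directed_le]
  exact hd

theorem eq_zero_of_dense_iUnion {ι : Type*} {V : ι → Submodule ℝ G}
    (hd : Dense (⋃ i, (V i : Set G))) {f : G} (h : ∀ i, f ∈ (V i)ᗮ) : f = 0 := by
  refine hd.eq_zero_of_inner_left ℝ fun v hv => ?_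
  obtain ⟨i, hi⟩ := Set.mem_iUnion.1 hv
  exact Submodule.inner_left_of_mem_orthogonal hi (h i)

/-- The orthonormal bases of `V 0` and of the spaces `V (j + 1) ⊖ V j`, `j ≥ 0`, make up an
orthonormal basis of the whole space. -/
theorem orthonormal_sumElim_levels {α β : Type*} {V : ℤ → Submodule ℝ G}
    (hV : Monotone V) {a : α → G} {b : ℕ → β → G}
    (ha : Orthonormal ℝ a) (hb : ∀ j, Orthonormal ℝ (b j)) (ha0 : ∀ i, a i ∈ V 0)
    (hbj : ∀ (j : ℕ) i, b j i ∈ (V j)ᗮ ⊓ V (j + 1)) :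
    Orthonormal ℝ (Sum.elim a fun p : ℕ × β => b p.1 p.2) := by
  have key : ∀ (j k : ℕ) i i', j < k → ⟪b j i, b k i'⟫_ℝ = 0 := fun j k i i' hjk =>
    (hbj k i').1 _ (hV (by lia) (hbj j i).2)
  have key0 : ∀ i (k : ℕ) i', ⟪a i, b k i'⟫_ℝ = 0 := fun i k i' =>
    (hbj k i').1 _ (hV (by lia) (ha0 i))
  refine ⟨?_, ?_⟩
  · rintro (i | ⟨j, i⟩)
    · exact ha.1 i
    · exact (hb j).1 i
  · rintro (i | ⟨j, i⟩) (i' | ⟨j', i'⟩) hne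
    · exact ha.2 (by simpa using hne)
    · exact key0 _ _ _
    · exact (real_inner_comm _ _).trans (key0 _ _ _)
    · rcases lt_trichotomy j j' with h | rfl | h
      · exact key _ _ _ _ h
      · exact (hb j).2 (by simpa using hne)
      · exact (real_inner_comm _ _).trans (key _ _ _ _ h)

variable [CompleteSpace G]

theorem hasOrthogonalProjection_of_isClosed {K : Submodule ℝ G} (hK : IsClosed (K : Set G)) :
    K.HasOrthogonalProjection := by
  have := hK.completeSpace_coe
  infer_instance

instance (s : Set G) : (closedSpan s).HasOrthogonalProjection :=
  hasOrthogonalProjection_of_isClosed (isClosed_closedSpan s)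

/-- The residual of projecting a vector of `K` onto the closed span still lies in `K` and is
orthogonal to `s`. All completeness statements below are reduced to this test. -/
theorem closedSpan_eq_of_orthogonal {s : Set G} {K : Submodule ℝ G} (hK : IsClosed (K : Set G))
    (hs : s ⊆ K) (h : ∀ f ∈ K, (∀ g ∈ s, ⟪g, f⟫_ℝ = 0) → f = 0) : closedSpan s = K := by
  refine le_antisymm (closedSpan_le hK hs) fun f hf => ?_
  have h1 := (closedSpan s).sub_starProjection_mem_orthogonal f
  have h2 : f - (closedSpan s).starProjection f ∈ K :=
    K.sub_mem hf (closedSpan_le hK hs (Submodule.starProjection_apply_mem _ _))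
  rw [sub_eq_zero.1 (h _ h2 (mem_orthogonal_closedSpan.1 h1))]
  exact Submodule.starProjection_apply_mem _ _

theorem dense_iUnion_of_orthogonal {ι : Type*} [Preorder ι] [IsDirectedOrder ι] [Nonempty ι]
    {V : ι → Submodule ℝ G} (hV : Monotone V)
    (h : ∀ f, (∀ i, f ∈ (V i)ᗮ) → f = 0) : Dense (⋃ i, (V i : Set G)) := by
  rw [← Submodule.coe_iSup_of_directed V hV.directed_le,
    Submodule.dense_iff_topologicalClosure_eq_top, Submodule.topologicalClosure_eq_top_iff,
    ← Submodule.iInf_orthogonal, eq_bot_iff]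
  exact fun f hf => h f (by simpa using hf)

/-- As `j` decreases the complements of `V j` increase, with dense union because the intersection of
the `V j` is trivial; so the complementary projections tend to the identity. -/
theorem tendsto_starProjection_zero {V : ℤ → Submodule ℝ G}
    [∀ j, (V j).HasOrthogonalProjection] (hV : Monotone V)
    (h0 : ⨅ j, V j = ⊥) (f : G) :
    Tendsto (fun j => (V j).starProjection f) atBot (𝓝 0) := by
  have h1 : Tendsto (fun j : ℤ => ((V (-j))ᗮ).starProjection f) atTop (𝓝 f) := by
    refine Submodule.starProjection_tendsto_self _
      (fun i j hij => Submodule.orthogonal_le (hV (neg_le_neg hij))) f ?_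
    rw [top_le_iff, Submodule.topologicalClosure_eq_top_iff, ← Submodule.iInf_orthogonal,
      eq_bot_iff, ← h0]
    refine le_iInf fun j => (iInf_le _ (-j)).trans ?_
    rw [neg_neg, Submodule.orthogonal_orthogonal]
  have h2 : Tendsto (fun j : ℤ => f - ((V (-(-j)))ᗮ).starProjection f) atBot (𝓝 (f - f)) :=
    tendsto_const_nhds.sub (h1.comp tendsto_neg_atBot_atTop)
  simpa using h2

/-- The expansion of a vector of the closed span of an orthonormal family. -/
theorem hasSum_of_mem_closedSpan {ι : Type*} {v : ι → G} (hv : Orthonormal ℝ v) {f : G}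
    (hf : f ∈ closedSpan (Set.range v)) : HasSum (fun i => ⟪v i, f⟫_ℝ • v i) f := by
  have hK := isClosed_closedSpan (Set.range v)
  have := hK.completeSpace_coe
  let v' : ι → closedSpan (Set.range v) := fun i => ⟨v i, subset_closedSpan _ ⟨i, rfl⟩⟩
  have hv' : Orthonormal ℝ v' :=
    ⟨fun i => hv.1 i, fun i j hij => hv.2 hij⟩
  have hb : (Submodule.span ℝ (Set.range v'))ᗮ = ⊥ := by
    rw [eq_bot_iff]
    intro x hx
    have h1 : (x : G) ∈ (closedSpan (Set.range v))ᗮ := by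
      rw [mem_orthogonal_closedSpan]
      rintro _ ⟨i, rfl⟩
      exact hx (v' i) (Submodule.subset_span ⟨i, rfl⟩)
    have h2 : (x : G) = 0 := inner_self_eq_zero.1 (h1 x x.2)
    simpa using h2
  have h := (HilbertBasis.mkOfOrthogonalEqBot hv' hb).hasSum_orthogonalProjectionOnto f
  rw [HilbertBasis.coe_mkOfOrthogonalEqBot] at h
  have h' := h.mapL (closedSpan (Set.range v)).subtypeL
  have e : ((closedSpan (Set.range v)).orthogonalProjectionOnto f : G) = f :=
    Submodule.starProjection_eq_self_iff.2 hf
  simpa [e, v'] using h'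

/-- If an orthonormal family is split in two, the closed span of the second part is the
orthogonal complement of the closed span of the first part in the closed span of the family. -/
theorem closedSpan_inr_eq {α β : Type*} {v : α ⊕ β → G} (hv : Orthonormal ℝ v) :
    closedSpan (Set.range fun b => v (Sum.inr b)) =
      (closedSpan (Set.range fun a => v (Sum.inl a)))ᗮ ⊓ closedSpan (Set.range v) := by
  refine closedSpan_eq_of_orthogonal ?_ ?_ ?_
  · exact (Submodule.isClosed_orthogonal _).inter (isClosed_closedSpan _)
  · rintro _ ⟨b, rfl⟩
    refine ⟨mem_orthogonal_closedSpan.2 ?_, subset_closedSpan _ ⟨_, rfl⟩⟩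
    rintro _ ⟨a, rfl⟩
    exact hv.2 (by simp)
  · rintro f ⟨h1, h2⟩ h3
    have h4 : f ∈ (closedSpan (Set.range v))ᗮ := by
      rw [mem_orthogonal_closedSpan]
      rintro _ ⟨a | b, rfl⟩
      · exact mem_orthogonal_closedSpan.1 h1 _ ⟨a, rfl⟩
      · exact h3 _ ⟨b, rfl⟩
    exact inner_self_eq_zero.1 (h4 f h2)

/-- A vector orthogonal to the whole family is orthogonal to every `V j`, by induction on `j ≥ 0`:
an element of `V (j + 1)` is its projection to `V j` plus an element of `V (j + 1) ⊖ V j`. Density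
then forces it to vanish. -/
theorem closedSpan_sumElim_levels {α β : Type*} {V : ℤ → Submodule ℝ G}
    (hc : ∀ j, IsClosed (V j : Set G)) (hV : Monotone V) (hd : Dense (⋃ j, (V j : Set G)))
    {a : α → G} {b : ℕ → β → G} (ha : closedSpan (Set.range a) = V 0)
    (hb : ∀ j : ℕ, closedSpan (Set.range (b j)) = (V j)ᗮ ⊓ V (j + 1)) :
    closedSpan (Set.range (Sum.elim a fun p : ℕ × β => b p.1 p.2)) = ⊤ := by
  refine closedSpan_eq_of_orthogonal isClosed_univ (fun _ _ => trivial) fun f _ hf => ?_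
  have h : ∀ j : ℕ, f ∈ (V j)ᗮ := by
    intro j
    induction j with
    | zero =>
      rw [Nat.cast_zero, ← ha, mem_orthogonal_closedSpan]
      rintro _ ⟨i, rfl⟩
      exact hf _ ⟨Sum.inl i, rfl⟩
    | succ j ih =>
      have := hasOrthogonalProjection_of_isClosed (hc j)
      have h1 : f ∈ ((V j)ᗮ ⊓ V (j + 1))ᗮ := by
        rw [← hb, mem_orthogonal_closedSpan]
        rintro _ ⟨i, rfl⟩
        exact hf _ ⟨Sum.inr (j, i), rfl⟩
      intro g hg
      push_cast at hg
      have h2 : (V j).starProjection g ∈ V (j + 1) :=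
        hV (by lia) (Submodule.starProjection_apply_mem _ _)
      have h3 := h1 _ ⟨Submodule.sub_starProjection_mem_orthogonal g, Submodule.sub_mem _ hg h2⟩
      rw [inner_sub_left, ih _ (Submodule.starProjection_apply_mem _ _), sub_zero] at h3
      exact h3
  refine eq_zero_of_dense_iUnion hd fun j => ?_
  -- Negative levels lie inside `V 0`.
  exact Submodule.orthogonal_le (hV (Int.self_le_toNat j)) (h j.toNat)

end ClosedSpan

/-! ### Closed tensor products of closed subspaces -/

section Tensor

variable {G H I A : Type*} [NormedAddCommGroup G] [InnerProductSpace ℝ G]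
  [NormedAddCommGroup H] [InnerProductSpace ℝ H]

/-- The arguments are freed from `S i` to its closed span one coordinate at a time: in a single slot
`T` is linear and continuous, so the preimage of `K` is a closed subspace. -/
theorem map_mem_of_mem_closedSpan [Fintype I] (T : ContinuousMultilinearMap ℝ (fun _ : I => G) H)
    {K : Submodule ℝ H} (hK : IsClosed (K : Set H)) (S : I → Set G)
    (hS : ∀ g : I → G, (∀ i, g i ∈ S i) → T g ∈ K) (g : I → G)
    (hg : ∀ i, g i ∈ closedSpan (S i)) : T g ∈ K := by
  classical
  suffices h : ∀ s : Finset I, ∀ g : I → G, (∀ i ∈ s, g i ∈ closedSpan (S i)) →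
      (∀ i ∉ s, g i ∈ S i) → T g ∈ K from
    h Finset.univ g (fun i _ => hg i) fun i hi => absurd (Finset.mem_univ i) hi
  intro s
  induction s using Finset.induction_on with
  | empty => exact fun g _ h => hS g fun i => h i (Finset.notMem_empty i)
  | insert i₀ s hi₀ ih =>
    intro g h1 h2
    have hcl : IsClosed (K.comap (T.toMultilinearMap.toLinearMap g i₀) : Set G) :=
      hK.preimage (T.cont.comp (continuous_const.update i₀ continuous_id))
    have hle := closedSpan_le hcl (s := S i₀) fun x hx => ih _ (fun i hi => by
        rw [Function.update_of_ne (ne_of_mem_of_not_mem hi hi₀)]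
        exact h1 i (Finset.mem_insert_of_mem hi)) (fun i hi => by
        by_cases h : i = i₀
        · subst h; simpa using hx
        · rw [Function.update_of_ne h]
          exact h2 i (by simp [h, hi]))
    have := hle (h1 i₀ (Finset.mem_insert_self _ _))
    rw [Submodule.mem_comap] at this
    simpa using this

/-- The closed subspace spanned by the tensors `T a g` with `g i` in `W i` for all `i`. -/
def tensorSpan (T : A → ContinuousMultilinearMap ℝ (fun _ : I => G) H)
    (W : I → Submodule ℝ G) : Submodule ℝ H :=
  closedSpan {h | ∃ a, ∃ g : I → G, (∀ i, g i ∈ W i) ∧ h = T a g}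

variable {T : A → ContinuousMultilinearMap ℝ (fun _ : I => G) H}

theorem mem_tensorSpan {W : I → Submodule ℝ G} (a : A) {g : I → G} (hg : ∀ i, g i ∈ W i) :
    T a g ∈ tensorSpan T W :=
  subset_closedSpan _ ⟨a, g, hg, rfl⟩

theorem tensorSpan_le {W : I → Submodule ℝ G} {K : Submodule ℝ H} (hK : IsClosed (K : Set H))
    (h : ∀ a, ∀ g : I → G, (∀ i, g i ∈ W i) → T a g ∈ K) : tensorSpan T W ≤ K :=
  closedSpan_le hK <| by rintro _ ⟨a, g, hg, rfl⟩; exact h a g hg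

theorem tensorSpan_mono {W W' : I → Submodule ℝ G} (h : ∀ i, W i ≤ W' i) :
    tensorSpan T W ≤ tensorSpan T W' :=
  tensorSpan_le (isClosed_closedSpan _) fun a _ hg => mem_tensorSpan a fun i => h i (hg i)

theorem tensorSpan_closedSpan [Fintype I] {J : I → Type*} (B : ∀ i, J i → G) :
    tensorSpan T (fun i => closedSpan (Set.range (B i))) =
      closedSpan (Set.range fun p : A × (∀ i, J i) => T p.1 fun i => B i (p.2 i)) := by
  refine le_antisymm (tensorSpan_le (isClosed_closedSpan _) fun a g hg => ?_)
    (closedSpan_le (isClosed_closedSpan _) ?_)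
  · refine map_mem_of_mem_closedSpan (T a) (isClosed_closedSpan _) (fun i => Set.range (B i))
      (fun g' hg' => ?_) g hg
    choose p hp using hg'
    exact subset_closedSpan _ ⟨(a, p), by simp [hp]⟩
  · rintro _ ⟨p, rfl⟩
    exact mem_tensorSpan p.1 fun i => subset_closedSpan _ ⟨_, rfl⟩

/-- The tensors `T a g` are total. -/
def IsTotal (T : A → ContinuousMultilinearMap ℝ (fun _ : I => G) H) : Prop :=
  ∀ f, (∀ a g, ⟪T a g, f⟫_ℝ = 0) → f = 0

/-- Projecting each factor to level `j` and letting `j` grow approximates every pure tensor, so a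
vector orthogonal to all levels is orthogonal to all pure tensors. -/
theorem dense_iUnion_tensorSpan [CompleteSpace G] [CompleteSpace H] (ht : IsTotal T)
    {W : I → ℤ → Submodule ℝ G} (hc : ∀ i j, IsClosed (W i j : Set G))
    (hW : ∀ i, Monotone (W i)) (hd : ∀ i, Dense (⋃ j, (W i j : Set G))) :
    Dense (⋃ j, (tensorSpan T (fun i => W i j) : Set H)) := by
  have := fun i j => hasOrthogonalProjection_of_isClosed (hc i j)
  refine dense_iUnion_of_orthogonal
    (fun j k hjk => tensorSpan_mono fun i => hW i hjk) fun f hf => ht f fun a g => ?_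
  have h2 : Tendsto (fun j => T a (fun i => (W i j).starProjection (g i))) atTop (𝓝 (T a g)) :=
    ((T a).cont.tendsto _).comp
      (tendsto_pi_nhds.2 fun i => tendsto_starProjection_self (hW i) (hd i) (g i))
  have h3 := (h2.inner (𝕜 := ℝ) (tendsto_const_nhds (x := f)))
  refine tendsto_nhds_unique h3 (tendsto_const_nhds.congr fun j => ?_)
  exact (hf j _ (mem_tensorSpan a fun i => Submodule.starProjection_apply_mem _ _)).symm

variable [Fintype I] [DecidableEq A]

/-- The maps `T a` are isometric tensor product maps with orthogonal ranges. -/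
def IsTensor (T : A → ContinuousMultilinearMap ℝ (fun _ : I => G) H) : Prop :=
  ∀ a b g h, ⟪T a g, T b h⟫_ℝ = if a = b then ∏ i, ⟪g i, h i⟫_ℝ else 0

theorem IsTensor.orthonormal (hT : IsTensor T) {J : I → Type*} {B : ∀ i, J i → G}
    (hB : ∀ i, Orthonormal ℝ (B i)) :
    Orthonormal ℝ fun p : A × (∀ i, J i) => T p.1 fun i => B i (p.2 i) := by
  classical
  rw [orthonormal_iff_ite]
  rintro ⟨a, p⟩ ⟨b, q⟩
  rw [hT]
  simp only [fun i => orthonormal_iff_ite.1 (hB i), Prod.mk.injEq, funext_iff]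
  by_cases hab : a = b
  · simp only [hab, true_and, if_true]
    rw [Finset.prod_ite_zero]
    simp
  · simp [hab]

/-- The projection of a pure tensor is the tensor of the projections: inner products with tensors
from `W` factor, and each factor sees only the projection of `g i`. -/
theorem IsTensor.sub_mem_orthogonal (hT : IsTensor T) (W : I → Submodule ℝ G)
    [∀ i, (W i).HasOrthogonalProjection] (a : A) (g : I → G) :
    T a g - T a (fun i => (W i).starProjection (g i)) ∈ (tensorSpan T W)ᗮ := by
  rw [tensorSpan, mem_orthogonal_closedSpan]
  rintro _ ⟨b, h, hh, rfl⟩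
  rw [inner_sub_right, hT, hT, sub_eq_zero]
  split_ifs with hab
  · refine Finset.prod_congr rfl fun i _ => ?_
    rw [← sub_eq_zero, ← inner_sub_right]
    exact Submodule.sub_starProjection_mem_orthogonal _ _ (hh i)
  · rfl

/-- For `f` in every level, the pairing with `T a g` does not change when all `g i` are projected to
level `j`; as `j → -∞` these projections tend to `0`. Some coordinate must exist, since otherwise `T
a 0` need not vanish. -/
theorem IsTensor.iInf_tensorSpan [CompleteSpace G] [Nonempty I] (hT : IsTensor T) (ht : IsTotal T)
    {W : I → ℤ → Submodule ℝ G} (hc : ∀ i j, IsClosed (W i j : Set G))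
    (hW : ∀ i, Monotone (W i)) (h0 : ∀ i, ⨅ j, W i j = ⊥) :
    ⨅ j, tensorSpan T (fun i => W i j) = ⊥ := by
  have := fun i j => hasOrthogonalProjection_of_isClosed (hc i j)
  rw [eq_bot_iff]
  intro f hf
  refine ht f fun a g => ?_
  have h1 : ∀ j, ⟪T a g, f⟫_ℝ = ⟪T a (fun i => (W i j).starProjection (g i)), f⟫_ℝ := fun j => by
    rw [← sub_eq_zero, ← inner_sub_left]
    exact Submodule.inner_left_of_mem_orthogonal (Submodule.mem_iInf _ |>.1 hf j)
      (hT.sub_mem_orthogonal (fun i => W i j) a g)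
  have h2 : Tendsto (fun j => T a (fun i => (W i j).starProjection (g i))) atBot (𝓝 (T a 0)) :=
    ((T a).cont.tendsto _).comp
      (tendsto_pi_nhds.2 fun i => tendsto_starProjection_zero (hW i) (h0 i) (g i))
  have h3 := (h2.inner (𝕜 := ℝ) (tendsto_const_nhds (x := f)))
  rw [(T a).map_zero, inner_zero_left] at h3
  exact tendsto_nhds_unique (tendsto_const_nhds.congr h1) h3

end Tensor

/-! ### Normalized dilations and translations -/

section Rescale

variable {X F : Type*} [NormedAddCommGroup X] [NormedSpace ℝ X] [FiniteDimensional ℝ X]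
  [MeasureSpace X] [BorelSpace X] [(volume : Measure X).IsAddHaarMeasure]
  [NormedAddCommGroup F]

/-- Weighting the source measure by the Jacobian makes the affine map measure preserving; the weight
is removed again by the factor `√(c ^ n)` in the normalized dilation. -/
theorem measurePreserving_smul_sub {c : ℝ} (hc : 0 < c) (b : X) :
    MeasurePreserving (fun x : X => c • x - b)
      (ENNReal.ofReal (c ^ Module.finrank ℝ X) • volume) volume := by
  have h1 : MeasurePreserving (fun x : X => c • x)
      (ENNReal.ofReal (c ^ Module.finrank ℝ X) • volume) volume := by
    refine ⟨measurable_const_smul c, ?_⟩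
    have hp : 0 < c ^ Module.finrank ℝ X := pow_pos hc _
    rw [Measure.map_smul, Measure.map_addHaar_smul _ hc.ne', smul_smul,
      abs_of_pos (inv_pos.2 hp), ← ENNReal.ofReal_mul hp.le, mul_inv_cancel₀ hp.ne',
      ENNReal.ofReal_one, one_smul]
  exact (measurePreserving_sub_right volume b).comp h1

theorem quasiMeasurePreserving_smul_sub {c : ℝ} (hc : 0 < c) (b : X) :
    Measure.QuasiMeasurePreserving (fun x : X => c • x - b) volume volume :=
  (measurePreserving_sub_right volume b).quasiMeasurePreserving.comp
    (Measure.quasiMeasurePreserving_smul _ hc.ne')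

theorem memLp_comp_smul_sub {c : ℝ} (hc : 0 < c) (b : X) {f : X → F}
    (hf : MemLp f 2 volume) : MemLp (fun x => f (c • x - b)) 2 volume := by
  have h := hf.comp_measurePreserving (measurePreserving_smul_sub hc b)
  have hp : ENNReal.ofReal (c ^ Module.finrank ℝ X) ≠ 0 := by simp [pow_pos hc]
  have h' := h.smul_measure (c := (ENNReal.ofReal (c ^ Module.finrank ℝ X))⁻¹)
    (ENNReal.inv_ne_top.2 hp)
  rwa [smul_smul, ENNReal.inv_mul_cancel hp ENNReal.ofReal_ne_top, one_smul] at h'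

variable [NormedSpace ℝ F]

theorem eLpNorm_comp_smul_sub {c : ℝ} (hc : 0 < c) (b : X) {f : X → F}
    (hf : AEStronglyMeasurable f volume) :
    eLpNorm (fun x => √(c ^ Module.finrank ℝ X) • f (c • x - b)) 2 volume =
      eLpNorm f 2 volume := by
  have hp : 0 < c ^ Module.finrank ℝ X := pow_pos hc _
  rw [← eLpNorm_comp_measurePreserving hf (measurePreserving_smul_sub hc b),
    eLpNorm_smul_measure_of_ne_zero (by simpa using hp)]
  have : (fun x => √(c ^ Module.finrank ℝ X) • f (c • x - b)) =
      √(c ^ Module.finrank ℝ X) • (f ∘ fun x => c • x - b) := rfl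
  rw [this, eLpNorm_const_smul, smul_eq_mul]
  congr 1
  rw [ENNReal.ofReal_rpow_of_pos hp, Real.enorm_eq_ofReal (Real.sqrt_nonneg _), Real.sqrt_eq_rpow]
  norm_num

theorem memLp_smul_comp_smul_sub {c : ℝ} (hc : 0 < c) (b : X) {f : X → F}
    (hf : MemLp f 2 volume) :
    MemLp (fun x => √(c ^ Module.finrank ℝ X) • f (c • x - b)) 2 volume :=
  (memLp_comp_smul_sub hc b hf).const_smul _

/-- The normalized dilated translate `f ↦ c^{n/2} f(c · - b)` on the square integrable functions
on an `n`-dimensional space. -/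
def rescale {c : ℝ} (hc : 0 < c) (b : X) :
    Lp F 2 (volume : Measure X) →ₗᵢ[ℝ] Lp F 2 (volume : Measure X) where
  toFun f := (memLp_smul_comp_smul_sub hc b (Lp.memLp f)).toLp _
  map_add' f g := by
    rw [← MemLp.toLp_add]
    refine MemLp.toLp_congr _ _ ?_
    filter_upwards [(quasiMeasurePreserving_smul_sub hc b).ae_eq_comp (Lp.coeFn_add f g)] with x hx
    rw [Pi.add_apply, ← smul_add]
    exact congrArg _ hx
  map_smul' r f := by
    rw [RingHom.id_apply, ← MemLp.toLp_const_smul]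
    refine MemLp.toLp_congr _ _ ?_
    filter_upwards [(quasiMeasurePreserving_smul_sub hc b).ae_eq_comp (Lp.coeFn_smul r f)]
      with x hx
    rw [Pi.smul_apply, smul_comm r]
    exact congrArg _ hx
  norm_map' f := by
    change ‖(memLp_smul_comp_smul_sub hc b (Lp.memLp f)).toLp _‖ = _
    rw [Lp.norm_toLp, Lp.norm_def]
    exact congrArg _ (eLpNorm_comp_smul_sub hc b (Lp.aestronglyMeasurable f))

theorem coeFn_rescale {c : ℝ} (hc : 0 < c) (b : X) (f : Lp F 2 (volume : Measure X)) :
    rescale hc b f =ᵐ[volume] fun x => √(c ^ Module.finrank ℝ X) • f (c • x - b) :=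
  MemLp.coeFn_toLp (memLp_smul_comp_smul_sub hc b (Lp.memLp f))

theorem coeFn_rescale_of_ae_eq {c : ℝ} (hc : 0 < c) (b : X) {f : Lp F 2 (volume : Measure X)}
    {f' : X → F} (h : f =ᵐ[volume] f') :
    rescale hc b f =ᵐ[volume] fun x => √(c ^ Module.finrank ℝ X) • f' (c • x - b) := by
  filter_upwards [coeFn_rescale hc b f, (quasiMeasurePreserving_smul_sub hc b).ae_eq_comp h]
    with x h1 h2
  rw [h1, show f (c • x - b) = f' (c • x - b) from h2]

theorem rescale_rescale {c c' : ℝ} (hc : 0 < c) (hc' : 0 < c') (b b' : X)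
    (f : Lp F 2 (volume : Measure X)) :
    rescale hc b (rescale hc' b' f) = rescale (mul_pos hc hc') (c' • b + b') f := by
  refine Lp.ext ?_
  filter_upwards [coeFn_rescale_of_ae_eq hc b (coeFn_rescale hc' b' f),
    coeFn_rescale (mul_pos hc hc') (c' • b + b') f] with x h1 h2
  rw [h1, h2, smul_smul, mul_pow, Real.sqrt_mul (pow_pos hc _).le]
  congr 2
  module

theorem rescale_one_zero (h : (0 : ℝ) < 1) (f : Lp F 2 (volume : Measure X)) :
    rescale h 0 f = f := by
  refine Lp.ext ?_
  filter_upwards [coeFn_rescale h 0 f] with x h1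
  simp [h1]

/-- Numerical identities between dilation factors can then be substituted although the positivity
proof depends on the factor. -/
theorem rescale_congr {c c' : ℝ} (hc : 0 < c) (hc' : 0 < c') {b b' : X} (h : c = c')
    (hb : b = b') (f : Lp F 2 (volume : Measure X)) : rescale hc b f = rescale hc' b' f := by
  subst h hb; rfl

theorem rescale_inv_rescale {c : ℝ} (hc : 0 < c) (b : X) (f : Lp F 2 (volume : Measure X)) :
    rescale (inv_pos.2 hc) (-(c⁻¹ • b)) (rescale hc b f) = f := by
  rw [rescale_rescale, rescale_congr _ one_pos (inv_mul_cancel₀ hc.ne') _, rescale_one_zero]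
  rw [smul_neg, smul_smul, mul_inv_cancel₀ hc.ne', one_smul, neg_add_cancel]

theorem rescale_rescale_inv {c : ℝ} (hc : 0 < c) (b : X) (f : Lp F 2 (volume : Measure X)) :
    rescale hc b (rescale (inv_pos.2 hc) (-(c⁻¹ • b)) f) = f := by
  rw [rescale_rescale, rescale_congr _ one_pos (mul_inv_cancel₀ hc.ne') _, rescale_one_zero]
  rw [add_neg_cancel]

/-- The normalized dilated translate as a surjective isometry. -/
def rescaleEquiv {c : ℝ} (hc : 0 < c) (b : X) :
    Lp F 2 (volume : Measure X) ≃ₗᵢ[ℝ] Lp F 2 (volume : Measure X) where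
  toLinearEquiv := LinearEquiv.ofLinearMap (rescale hc b).toLinearMap
    (rescale (inv_pos.2 hc) (-(c⁻¹ • b))).toLinearMap
    (LinearMap.ext fun f => rescale_rescale_inv hc b f)
    (LinearMap.ext fun f => rescale_inv_rescale hc b f)
  norm_map' := (rescale hc b).norm_map

@[simp]
theorem rescaleEquiv_apply {c : ℝ} (hc : 0 < c) (b : X) (f : Lp F 2 (volume : Measure X)) :
    rescaleEquiv hc b f = rescale hc b f := rfl

end Rescale

/-! ### Images of closed subspaces under surjective isometries -/

section Isometry

variable {G : Type*} [NormedAddCommGroup G] [InnerProductSpace ℝ G]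

theorem map_closedSpan (e : G ≃ₗᵢ[ℝ] G) (s : Set G) :
    (closedSpan s).map e.toLinearEquiv.toLinearMap = closedSpan (e '' s) := by
  apply SetLike.coe_injective
  rw [closedSpan, closedSpan, Submodule.map_coe, Submodule.topologicalClosure_coe,
    Submodule.topologicalClosure_coe]
  change e.toHomeomorph '' _ = _
  rw [e.toHomeomorph.image_closure]
  congr 1
  have := Submodule.map_coe e.toLinearEquiv.toLinearMap (Submodule.span ℝ s)
  rw [Submodule.map_span] at this
  exact this.symm

theorem isClosed_map (e : G ≃ₗᵢ[ℝ] G) {K : Submodule ℝ G} (hK : IsClosed (K : Set G)) :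
    IsClosed (K.map e.toLinearEquiv.toLinearMap : Set G) := by
  rw [Submodule.map_coe]
  exact (e.toHomeomorph.isClosed_image).2 hK

theorem mem_map_iff (e : G ≃ₗᵢ[ℝ] G) {K : Submodule ℝ G} {f : G} :
    e f ∈ K.map e.toLinearEquiv.toLinearMap ↔ f ∈ K :=
  ⟨fun ⟨_, hg, h⟩ => e.injective h ▸ hg, fun h => ⟨f, h, rfl⟩⟩

theorem map_orthogonal (e : G ≃ₗᵢ[ℝ] G) (K : Submodule ℝ G) :
    Kᗮ.map e.toLinearEquiv.toLinearMap = (K.map e.toLinearEquiv.toLinearMap)ᗮ := by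
  ext f
  obtain ⟨f, rfl⟩ := e.surjective f
  rw [mem_map_iff]
  constructor
  · rintro h _ ⟨g, hg, rfl⟩
    exact (e.inner_map_map g f).trans (h g hg)
  · intro h g hg
    exact (e.inner_map_map g f).symm.trans (h _ ((mem_map_iff e).2 hg))

theorem map_inf_eq (e : G ≃ₗᵢ[ℝ] G) (K L : Submodule ℝ G) :
    (K ⊓ L).map e.toLinearEquiv.toLinearMap =
      K.map e.toLinearEquiv.toLinearMap ⊓ L.map e.toLinearEquiv.toLinearMap :=
  Submodule.map_inf _ e.injective

end Isometry

/-! ### Tensor products of univariate functions -/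

section TensorL2

variable {d m : ℕ}

theorem quasiMeasurePreserving_coord (i : Fin d) :
    Measure.QuasiMeasurePreserving (fun x : E d => x i) volume volume :=
  (Measure.quasiMeasurePreserving_eval (fun _ : Fin d => (volume : Measure ℝ)) i).comp
    (PiLp.volume_preserving_ofLp (Fin d)).quasiMeasurePreserving

theorem integral_prod_coord (f : Fin d → ℝ → ℝ) :
    ∫ x : E d, ∏ i, f i (x i) = ∏ i, ∫ t, f i t :=
  ((PiLp.volume_preserving_ofLp (Fin d)).integral_comp
    (MeasurableEquiv.toLp 2 (Fin d → ℝ)).symm.measurableEmbedding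
    (fun x => ∏ i, f i (x i))).trans (integral_fintype_prod_volume_eq_prod f)

theorem integrable_prod_coord {f : Fin d → ℝ → ℝ} (hf : ∀ i, Integrable (f i)) :
    Integrable fun x : E d => ∏ i, f i (x i) :=
  ((PiLp.volume_preserving_ofLp (Fin d)).integrable_comp_emb
    (MeasurableEquiv.toLp 2 (Fin d → ℝ)).symm.measurableEmbedding).2
    (Integrable.fintype_prod (μ := fun _ => volume) hf)

theorem memLp_prod_coord {f : Fin d → ℝ → ℝ} (hf : ∀ i, MemLp (f i) 2 volume) :
    MemLp (fun x : E d => ∏ i, f i (x i)) 2 volume := by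
  have hm : AEStronglyMeasurable (fun x : E d => ∏ i, f i (x i)) volume :=
    Finset.aestronglyMeasurable_fun_prod _ fun i _ =>
      (hf i).1.comp_quasiMeasurePreserving (quasiMeasurePreserving_coord i)
  rw [memLp_two_iff_integrable_sq hm]
  simp only [← Finset.prod_pow]
  exact integrable_prod_coord fun i => (hf i).integrable_sq

theorem ae_eq_prod_coord {f g : Fin d → ℝ → ℝ} (h : ∀ i, f i =ᵐ[volume] g i) :
    (fun x : E d => ∏ i, f i (x i)) =ᵐ[volume] fun x => ∏ i, g i (x i) := by
  have : ∀ᵐ x : E d, ∀ i, f i (x i) = g i (x i) :=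
    ae_all_iff.2 fun i => (quasiMeasurePreserving_coord i).ae_eq_comp (h i)
  filter_upwards [this] with x hx
  simp only [hx]

theorem smul_single (c y : ℝ) (a : Fin m) :
    c • EuclideanSpace.single a y = EuclideanSpace.single a (c * y) := by
  ext i
  by_cases h : i = a <;> simp [h]

theorem memLp_single (a : Fin m) {f : E d → ℝ} (hf : MemLp f 2 volume) :
    MemLp (fun x => EuclideanSpace.single a (f x)) 2 volume := by
  rw [memLp_piLp_iff]
  intro i
  by_cases h : i = a
  · simpa [h] using hf
  · simp [h]

/-- The vector field with the single nonzero component `∏ i, g i (x i)`, in position `a`. -/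
def tensorField (a : Fin m) (g : Fin d → ℝ → ℝ) : E d → E m :=
  fun x => EuclideanSpace.single a (∏ i, g i (x i))

theorem memLp_tensorField (a : Fin m) (g : Fin d → L2R) :
    MemLp (tensorField (d := d) a fun i => g i) 2 volume :=
  memLp_single a (memLp_prod_coord fun i => Lp.memLp (g i))

theorem inner_tensorField (a b : Fin m) (g h : Fin d → L2R) :
    ⟪(memLp_tensorField a g).toLp _, (memLp_tensorField b h).toLp _⟫_ℝ =
      if a = b then ∏ i, ⟪g i, h i⟫_ℝ else 0 := by
  rw [L2.inner_def]
  have h1 : ∫ x, ⟪(memLp_tensorField a g).toLp _ x, (memLp_tensorField b h).toLp _ x⟫_ℝ =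
      ∫ x : E d, if a = b then ∏ i, ⟪g i (x i), h i (x i)⟫_ℝ else 0 := by
    refine integral_congr_ae ?_
    filter_upwards [(memLp_tensorField a g).coeFn_toLp, (memLp_tensorField b h).coeFn_toLp]
      with x hx hx'
    rw [hx, hx', tensorField, tensorField, EuclideanSpace.inner_single_left]
    by_cases hab : a = b
    · simp [hab, ← Finset.prod_mul_distrib, mul_comm]
    · simp [hab]
  rw [h1]
  split_ifs
  · rw [integral_prod_coord fun i t => ⟪g i t, h i t⟫_ℝ]
    rfl
  · simp

theorem coeFn_update (g : Fin d → L2R) (i : Fin d) (x : L2R) :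
    (fun j => (Function.update g i x j : ℝ → ℝ)) =
      Function.update (fun j => (g j : ℝ → ℝ)) i x := by
  ext1 j
  by_cases h : j = i
  · subst h; simp
  · simp [h]

/-- The tensor product `g ↦ (∏ i, g i (x i)) e_a` as a multilinear map. -/
def tensorMultilinear (d : ℕ) (a : Fin m) : MultilinearMap ℝ (fun _ : Fin d => L2R) (L2 d m) where
  toFun g := (memLp_tensorField a g).toLp _
  map_update_add' {inst} g i x y := by
    -- The multilinearity axioms quantify over all decidability instances, so the given one is
    -- identified with the canonical one.
    obtain rfl : inst = instDecidableEqFin d := Subsingleton.elim _ _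
    rw [← MemLp.toLp_add]
    refine MemLp.toLp_congr _ _ ?_
    filter_upwards [(quasiMeasurePreserving_coord i).ae_eq_comp (Lp.coeFn_add x y)] with z hz
    simp only [Function.comp_apply, Pi.add_apply] at hz
    simp only [tensorField, Pi.add_apply, coeFn_update, ← PiLp.single_add]
    rw [← Finset.mul_prod_erase _ _ (Finset.mem_univ i),
      ← Finset.mul_prod_erase _ _ (Finset.mem_univ i),
      ← Finset.mul_prod_erase _ _ (Finset.mem_univ i)]
    simp only [Function.update_self, hz]
    rw [add_mul]
    congr 2 <;>
    · congr 1
      refine Finset.prod_congr rfl fun j hj => ?_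
      rw [Function.update_of_ne (Finset.ne_of_mem_erase hj),
        Function.update_of_ne (Finset.ne_of_mem_erase hj)]
  map_update_smul' {inst} g i c x := by
    obtain rfl : inst = instDecidableEqFin d := Subsingleton.elim _ _
    rw [← MemLp.toLp_const_smul]
    refine MemLp.toLp_congr _ _ ?_
    filter_upwards [(quasiMeasurePreserving_coord i).ae_eq_comp (Lp.coeFn_smul c x)] with z hz
    simp only [Function.comp_apply, Pi.smul_apply] at hz
    simp only [tensorField, Pi.smul_apply, coeFn_update]
    rw [← Finset.mul_prod_erase _ _ (Finset.mem_univ i),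
      ← Finset.mul_prod_erase _ _ (Finset.mem_univ i)]
    simp only [Function.update_self, hz, smul_eq_mul, mul_assoc]
    rw [smul_single]
    congr 3
    refine Finset.prod_congr rfl fun j hj => ?_
    rw [Function.update_of_ne (Finset.ne_of_mem_erase hj),
      Function.update_of_ne (Finset.ne_of_mem_erase hj)]

/-- The tensor product `g ↦ (∏ i, g i (x i)) e_a` as a continuous multilinear map. -/
def tensor (d m : ℕ) (a : Fin m) : ContinuousMultilinearMap ℝ (fun _ : Fin d => L2R) (L2 d m) :=
  (tensorMultilinear d a).mkContinuous 1 fun g => by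
    rw [one_mul, ← sq_le_sq₀ (norm_nonneg _) (Finset.prod_nonneg fun _ _ => norm_nonneg _),
      ← real_inner_self_eq_norm_sq, ← Finset.prod_pow]
    refine ((inner_tensorField a a g g).trans ?_).le
    simp

theorem tensor_apply (a : Fin m) (g : Fin d → L2R) :
    tensor d m a g = (memLp_tensorField a g).toLp _ := rfl

theorem isTensor_tensor (d m : ℕ) : IsTensor (tensor d m) := inner_tensorField

theorem coeFn_tensor (a : Fin m) {g : Fin d → L2R} {g' : Fin d → ℝ → ℝ}
    (h : ∀ i, g i =ᵐ[volume] g' i) :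
    tensor d m a g =ᵐ[volume] fun x => EuclideanSpace.single a (∏ i, g' i (x i)) := by
  filter_upwards [(memLp_tensorField a g).coeFn_toLp, ae_eq_prod_coord h] with x h1 h2
  rw [tensor_apply, h1, tensorField, h2]

/-- The normalizing factor splits as `√(c ^ d) = (√c) ^ d`, one factor `√c` for each coordinate. -/
theorem rescale_tensor {c : ℝ} (hc : 0 < c) (b : E d) (a : Fin m) (g : Fin d → L2R) :
    rescale hc b (tensor d m a g) = tensor d m a fun i => rescale hc (b i) (g i) := by
  refine Lp.ext ?_
  filter_upwards [coeFn_rescale_of_ae_eq hc b (coeFn_tensor a fun i => ae_eq_refl (g i)),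
    coeFn_tensor a fun i => coeFn_rescale hc (b i) (g i)] with x h1 h2
  rw [h1, h2, smul_single]
  congr 1
  simp [Finset.prod_mul_distrib, Real.sqrt_eq_rpow, ← Real.rpow_natCast, ← Real.rpow_mul hc.le,
    mul_comm]

end TensorL2

/-! ### Totality of the pure tensors -/

section Total

variable {d m : ℕ}

/-- Boxes form a π-system generating the σ-algebra. Restricting to `B`, where `f` is integrable,
makes the sets with vanishing integral closed under complements and disjoint countable unions. -/
theorem setIntegral_eq_zero_of_box {f : (Fin d → ℝ) → ℝ} {B : Set (Fin d → ℝ)}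
    (hf : IntegrableOn f B) (hB : MeasurableSet B)
    (h : ∀ s : Fin d → Set ℝ, (∀ i, MeasurableSet (s i)) →
      ∫ x in Set.pi Set.univ s ∩ B, f x = 0)
    {s : Set (Fin d → ℝ)} (hs : MeasurableSet s) : ∫ x in s ∩ B, f x = 0 := by
  have huniv : ∫ x in B, f x = 0 := by simpa using h (fun _ => Set.univ) fun _ => .univ
  refine MeasurableSpace.induction_on_inter (C := fun s _ => ∫ x in s ∩ B, f x = 0)
    generateFrom_pi.symm isPiSystem_pi (by simp) ?_ (fun t ht ih => ?_) (fun t hd ht ih => ?_) s hs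
  · rintro _ ⟨s, hs, rfl⟩
    exact h s fun i => hs i trivial
  · have := integral_inter_add_sdiff ht hf
    rw [Set.inter_comm, ih, huniv, zero_add] at this
    rwa [Set.inter_comm]
  · rw [Set.iUnion_inter, integral_iUnion (fun i => (ht i).inter hB)
      (fun i j hij => (hd hij).mono Set.inter_subset_left Set.inter_subset_left)
      (hf.mono_set (Set.iUnion_subset fun i => Set.inter_subset_right))]
    simp [ih]

theorem ae_eq_zero_of_box {f : (Fin d → ℝ) → ℝ} (hf : MemLp f 2 volume)
    (h : ∀ s : Fin d → Set ℝ, (∀ i, MeasurableSet (s i)) → (∀ i, volume (s i) < ∞) →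
      ∫ x in Set.pi Set.univ s, f x = 0) : f =ᵐ[volume] 0 := by
  let J : ℕ → Set ℝ := fun n => Set.Icc (-n) n
  let B : ℕ → Set (Fin d → ℝ) := fun n => Set.pi Set.univ fun _ => J n
  have hB : ∀ n, MeasurableSet (B n) := fun n => .univ_pi fun _ => measurableSet_Icc
  have hfin : ∀ n, volume (B n) < ∞ := fun n =>
    (isCompact_univ_pi fun _ => isCompact_Icc).measure_lt_top
  have hU : ⋃ n, B n = Set.univ := by
    refine Set.eq_univ_of_forall fun x => Set.mem_iUnion.2 ?_
    obtain ⟨n, hn⟩ := exists_nat_ge ‖x‖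
    exact ⟨n, fun i _ => abs_le.1 ((norm_le_pi_norm x i).trans hn)⟩
  have key : ∀ n, ∀ᵐ x ∂volume.restrict (B n), f x = 0 := fun n => by
    have : IsFiniteMeasure (volume.restrict (B n)) := ⟨by simpa using hfin n⟩
    -- On a cube of finite measure, square integrable functions are integrable; the cubes `B n`
    -- exhaust the space.
    have hint : IntegrableOn f (B n) := (hf.restrict (B n)).integrable (by norm_num)
    refine hint.ae_eq_zero_of_forall_setIntegral_eq_zero fun s hs _ => ?_
    rw [Measure.restrict_restrict hs]
    refine setIntegral_eq_zero_of_box hint (hB n) (fun s hs => ?_) hs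
    rw [← Set.pi_inter_distrib]
    exact h _ (fun i => (hs i).inter measurableSet_Icc)
      fun i => (measure_mono Set.inter_subset_right).trans_lt (by simp [J])
  have := (ae_restrict_iUnion_iff B fun x => f x = 0).2 key
  rwa [hU, Measure.restrict_univ] at this

/-- Tensors of indicator functions of sets of finite measure already suffice: pairing with them
gives the integrals of the components of `f` over boxes. -/
theorem isTotal_tensor (d m : ℕ) : IsTotal (tensor d m) := by
  intro f hf
  refine Lp.ext ?_
  suffices h : ∀ a, (fun x : Fin d → ℝ => f (WithLp.toLp 2 x) a) =ᵐ[volume] 0 by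
    have h' : ∀ a, ∀ᵐ x : E d, f x a = 0 := fun a =>
      (PiLp.volume_preserving_ofLp (Fin d)).quasiMeasurePreserving.ae (h a)
    filter_upwards [ae_all_iff.2 h', Lp.coeFn_zero (E m) 2 (volume : Measure (E d))] with x hx h0
    rw [h0]
    ext a
    exact hx a
  intro a
  refine ae_eq_zero_of_box (((Lp.memLp f).eval_piLp a).comp_measurePreserving
    (PiLp.volume_preserving_toLp (Fin d))) fun s hs hsf => ?_
  let g : Fin d → L2R := fun i => indicatorConstLp 2 (hs i) (hsf i).ne (1 : ℝ)
  have hg : ∀ i, g i =ᵐ[volume] (s i).indicator fun _ => (1 : ℝ) := fun i =>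
    indicatorConstLp_coeFn
  have h1 := hf a g
  rw [L2.inner_def] at h1
  have h2 : ∫ x, ⟪tensor d m a g x, f x⟫_ℝ =
      ∫ x : E d, (Set.pi Set.univ s).indicator (fun x => f (WithLp.toLp 2 x) a) x.ofLp := by
    refine integral_congr_ae ?_
    filter_upwards [coeFn_tensor a hg] with x hx
    rw [hx, EuclideanSpace.inner_single_left]
    by_cases hxs : x.ofLp ∈ Set.pi Set.univ s
    · have : ∀ i, x i ∈ s i := fun i => hxs i trivial
      simp [this]
    · obtain ⟨i, hi⟩ : ∃ i, x i ∉ s i := by simpa using hxs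
      rw [Set.indicator_of_notMem hxs, Finset.prod_eq_zero (Finset.mem_univ i)
        (Set.indicator_of_notMem hi _)]
      simp
  rw [h2, (PiLp.volume_preserving_ofLp (Fin d)).integral_comp
    (MeasurableEquiv.toLp 2 (Fin d → ℝ)).symm.measurableEmbedding
    ((Set.pi Set.univ s).indicator fun x => f (WithLp.toLp 2 x) a),
    integral_indicator (.univ_pi hs)] at h1
  exact h1

end Total

/-! ### Univariate multiresolution analyses with several scaling functions -/

section Multi

theorem rescale_one_rescale {c : ℝ} (hc : 0 < c) (b : ℝ) (f : L2R) :
    rescale one_pos b (rescale hc 0 f) = rescale hc 0 (rescale one_pos (c * b) f) := by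
  rw [rescale_rescale, rescale_rescale]
  exact rescale_congr _ _ (mul_comm _ _) (by simp) f

theorem rescale_zero_comm {c c' : ℝ} (hc : 0 < c) (hc' : 0 < c') (f : L2R) :
    rescale hc (0 : ℝ) (rescale hc' 0 f) = rescale hc' 0 (rescale hc 0 f) := by
  rw [rescale_rescale, rescale_rescale]
  exact rescale_congr _ _ (mul_comm _ _) (by simp) f

/-- A dyadic multiresolution analysis `W` of `L²(ℝ)`, with an orthonormal basis of `W 1` indexed by
a type, an element of `R` and an integer; the elements of type `false` form a basis of `W 0`. -/
structure IsMultiMRA {R : Type} (W : ℤ → Submodule ℝ L2R) (B : Bool × R × ℤ → L2R) : Prop where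
  isClosed : ∀ j, IsClosed (W j : Set L2R)
  mono : Monotone W
  iInf_eq : ⨅ j, W j = ⊥
  dense : Dense (⋃ j, (W j : Set L2R))
  dilation : ∀ j f, rescale two_pos 0 f ∈ W (j + 1) ↔ f ∈ W j
  translation : ∀ (j : ℕ) (k : ℤ) (f : L2R), f ∈ W j → rescale one_pos (k : ℝ) f ∈ W j
  orthonormal : Orthonormal ℝ B
  span_zero : closedSpan (Set.range fun p => B (false, p)) = W 0
  span_one : closedSpan (Set.range B) = W 1

/-- Dilation by `n` commutes with dilation by `2`, and translating a dilated function by `k` amounts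
to translating the original by `n k`. The latter is an integer because `n` is, which preserves
translation invariance. -/
theorem IsMultiMRA.map {R : Type} {W : ℤ → Submodule ℝ L2R} {B : Bool × R × ℤ → L2R}
    (h : IsMultiMRA W B) {n : ℕ} (hn : (0 : ℝ) < n) :
    IsMultiMRA (fun j => (W j).map (rescaleEquiv hn (0 : ℝ)).toLinearEquiv.toLinearMap)
      fun p => rescaleEquiv hn 0 (B p) where
  isClosed j := isClosed_map _ (h.isClosed j)
  mono _ _ hij := Submodule.map_mono (h.mono hij)
  iInf_eq := by
    rw [eq_bot_iff]
    intro f hf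
    obtain ⟨f, rfl⟩ := (rescaleEquiv hn (0 : ℝ)).surjective f
    have : f ∈ ⨅ j, W j :=
      (Submodule.mem_iInf _).2 fun j => (mem_map_iff _).1 ((Submodule.mem_iInf _).1 hf j)
    rw [h.iInf_eq, Submodule.mem_bot] at this
    simp [this]
  dense := by
    have := (rescaleEquiv hn (0 : ℝ)).surjective.denseRange.dense_image
      (rescaleEquiv hn (0 : ℝ)).continuous h.dense
    rwa [Set.image_iUnion] at this
  dilation j f := by
    obtain ⟨f, rfl⟩ := (rescaleEquiv hn (0 : ℝ)).surjective f
    rw [mem_map_iff, ← h.dilation, rescaleEquiv_apply, rescale_zero_comm, ← rescaleEquiv_apply hn,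
      mem_map_iff]
  translation j k f hf := by
    obtain ⟨f, rfl⟩ := (rescaleEquiv hn (0 : ℝ)).surjective f
    rw [mem_map_iff] at hf
    rw [rescaleEquiv_apply, rescale_one_rescale, ← rescaleEquiv_apply hn, mem_map_iff]
    exact_mod_cast h.translation j (n * k) f hf
  orthonormal := h.orthonormal.comp_linearIsometryEquiv _
  span_zero := by
    rw [← h.span_zero, map_closedSpan, ← Set.range_comp]
    rfl
  span_one := by
    rw [← h.span_one, map_closedSpan, ← Set.range_comp]
    rfl

theorem IsMultiMRA.reindex {R R' : Type} {W : ℤ → Submodule ℝ L2R} {B : Bool × R × ℤ → L2R}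
    (h : IsMultiMRA W B) (σ : R' × ℤ ≃ R × ℤ) : IsMultiMRA W fun p => B (p.1, σ p.2) where
  isClosed := h.isClosed
  mono := h.mono
  iInf_eq := h.iInf_eq
  dense := h.dense
  dilation := h.dilation
  translation := h.translation
  orthonormal := h.orthonormal.comp _ ((Equiv.refl Bool).prodCongr σ).injective
  span_zero := by
    rw [← h.span_zero, ← σ.surjective.range_comp fun p => B (false, p)]
    rfl
  span_one := by
    rw [← h.span_one, ← ((Equiv.refl Bool).prodCongr σ).surjective.range_comp B]
    rfl

/-- Translation invariance is not among the axioms of `IsScalarMRA` and is derived: at level `0`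
from the basis of translates, at higher levels because translation by `k` becomes translation by `2
k` one level below. -/
theorem exists_isMultiMRA_of_isScalarWavelet {φ ψ : ℝ → ℝ} (h : IsScalarWavelet φ ψ) :
    ∃ W, ∃ B : Bool × Unit × ℤ → L2R, IsMultiMRA W B ∧
      (∀ u k, B (false, u, k) =ᵐ[volume] fun x => φ (x - k)) ∧
      ∀ u k, B (true, u, k) =ᵐ[volume] fun x => ψ (x - k) := by
  obtain ⟨V, hV, hψ⟩ := h
  have hφ := hV.basis
  let a : ℤ → L2R := fun k => (hφ.memLp k).toLp _
  let b : ℤ → L2R := fun k => (hψ.memLp k).toLp _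
  have hao : Orthonormal ℝ a := hφ.orthonormal
  have hbo : Orthonormal ℝ b := hψ.orthonormal
  have has : closedSpan (Set.range a) = V 0 := hφ.closure_span
  have hbs : closedSpan (Set.range b) = (V 0)ᗮ ⊓ V 1 := hψ.closure_span
  have ha : ∀ k, a k ∈ V 0 := fun k => has ▸ subset_closedSpan _ ⟨k, rfl⟩
  have hb : ∀ k, b k ∈ (V 0)ᗮ ⊓ V 1 := fun k => hbs ▸ subset_closedSpan _ ⟨k, rfl⟩
  have hmono : Monotone V := monotone_int_of_le_succ hV.le_succ
  have hdil : ∀ j f, rescale two_pos 0 f ∈ V (j + 1) ↔ f ∈ V j := fun j f => by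
    -- The MRA axiom uses the unnormalized dilation, which differs from the isometry by the scalar
    -- `√2`.
    have h2 : (√2)⁻¹ ≠ 0 := by positivity
    rw [← Submodule.smul_mem_iff _ h2, ← hV.dilation]
    filter_upwards [Lp.coeFn_smul (√2)⁻¹ (rescale two_pos 0 f), coeFn_rescale two_pos 0 f]
      with x h3 h4
    rw [h3, Pi.smul_apply, h4, smul_smul]
    simp
  have htr : ∀ (j : ℕ) (k : ℤ) (f : L2R), f ∈ V j → rescale one_pos (k : ℝ) f ∈ V j := by
    intro j
    induction j with
    | zero =>
      intro k
      have hcl : IsClosed ((V 0).comap (rescale one_pos (k : ℝ)).toLinearMap : Set L2R) :=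
        (hV.isClosed 0).preimage (rescale one_pos (k : ℝ)).continuous
      rw [Nat.cast_zero]
      nth_rewrite 1 [← has]
      refine fun f hf => closedSpan_le hcl ?_ hf
      rintro _ ⟨i, rfl⟩
      have : rescale one_pos (k : ℝ) (a i) = a (i + k) := by
        refine Lp.ext ?_
        filter_upwards [coeFn_rescale_of_ae_eq one_pos (k : ℝ) (hφ.memLp i).coeFn_toLp,
          (hφ.memLp (i + k)).coeFn_toLp] with x h1 h2
        rw [h1, h2]
        simp only [one_pow, Real.sqrt_one, one_smul]
        congr 1
        push_cast
        ring
      change rescale one_pos (k : ℝ) (a i) ∈ V 0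
      rw [this]
      exact ha (i + k)
    | succ j ih =>
      intro k f hf
      obtain ⟨f, rfl⟩ := (rescaleEquiv two_pos (0 : ℝ)).surjective f
      rw [rescaleEquiv_apply] at hf ⊢
      push_cast at hf ⊢
      rw [hdil] at hf
      rw [rescale_one_rescale, hdil]
      exact_mod_cast ih (2 * k) f hf
  refine ⟨V, fun p => bif p.1 then b p.2.2 else a p.2.2, ⟨hV.isClosed, hmono, hV.iInf_eq, hV.dense,
    hdil, htr, ?_, ?_, ?_⟩, fun _ k => (hφ.memLp k).coeFn_toLp, fun _ k => (hψ.memLp k).coeFn_toLp⟩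
  · refine ⟨?_, ?_⟩
    · rintro ⟨_ | _, _, k⟩
      · exact hao.1 k
      · exact hbo.1 k
    · rintro ⟨_ | _, _, k⟩ ⟨_ | _, _, k'⟩ hne
      · exact hao.2 (by simpa using hne)
      · exact (hb k').1 _ (ha k)
      · exact (real_inner_comm _ _).trans ((hb k).1 _ (ha k'))
      · exact hbo.2 (by simpa using hne)
  · rw [← has]
    congr 1
    ext f
    simp
  · refine closedSpan_eq_of_orthogonal (hV.isClosed 1) ?_ fun f hf hfo => ?_
    · rintro _ ⟨⟨_ | _, _, k⟩, rfl⟩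
      · exact hmono zero_le_one (ha k)
      · exact (hb k).2
    · have h1 : f ∈ (V 0)ᗮ := by
        rw [← has, mem_orthogonal_closedSpan]
        rintro _ ⟨k, rfl⟩
        exact hfo _ ⟨(false, (), k), rfl⟩
      have h2 : f ∈ ((V 0)ᗮ ⊓ V 1)ᗮ := by
        rw [← hbs, mem_orthogonal_closedSpan]
        rintro _ ⟨k, rfl⟩
        exact hfo _ ⟨(true, (), k), rfl⟩
      exact inner_self_eq_zero.1 (h2 f ⟨h1, hf⟩)

/-- The functions `√n g(n · - r)`, `0 ≤ r < n`. -/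
def packet (n : ℕ) (g : ℝ → ℝ) (r : Fin n) : ℝ → ℝ := fun x => √n * g (n * x - r)

theorem exists_isMultiMRA_packet {φ ψ : ℝ → ℝ} (h : IsScalarWavelet φ ψ) {n : ℕ} (hn : 0 < n) :
    ∃ W, ∃ B : Bool × Fin n × ℤ → L2R, IsMultiMRA W B ∧
      ∀ b r (k : ℤ), B (b, r, k) =ᵐ[volume]
        fun x => packet n (if b = true then ψ else φ) r (x - k) := by
  have : NeZero n := ⟨hn.ne'⟩
  obtain ⟨W, B, hB, hφ, hψ⟩ := exists_isMultiMRA_of_isScalarWavelet h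
  have hn' : (0 : ℝ) < n := by exact_mod_cast hn
  -- Division with remainder: the translate by `k` of the `r`-th packet function is the dilation of
  -- the basis function with index `k * n + r`.
  let σ : Fin n × ℤ ≃ Unit × ℤ :=
    ((Equiv.prodComm _ _).trans (Int.divModEquiv n).symm).trans (Equiv.punitProd ℤ).symm
  have key : ∀ (r : Fin n) (k : ℤ) (g : ℝ → ℝ) (f : L2R),
      f =ᵐ[volume] (fun x => g (x - ((σ (r, k)).2 : ℤ))) →
      rescaleEquiv hn' 0 f =ᵐ[volume] fun x => packet n g r (x - k) := by
    intro r k g f hf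
    have hσ : (σ (r, k)).2 = k * n + r := rfl
    filter_upwards [coeFn_rescale_of_ae_eq hn' (0 : ℝ) hf] with x hx
    rw [rescaleEquiv_apply, hx, hσ, packet]
    simp only [Module.finrank_self, pow_one, smul_eq_mul]
    congr 2
    push_cast
    ring
  refine ⟨_, _, (hB.map hn').reindex σ, ?_⟩
  rintro (_ | _) r k
  · exact key r k φ _ (hφ _ _)
  · exact key r k ψ _ (hψ _ _)

end Multi

/-! ### Matrix bases from orthonormal families -/

section MatrixBasis

variable {d m : ℕ} {ι : Type}

/-- The vector `F (i, a, b)` is `U i` multiplied by the matrix unit `E_ab`. A matrix multiple of `U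
i` is therefore the scalar combination of the `F (i, a, b)` with the matrix entries as coefficients,
and matrix expansions are scalar expansions grouped by `i`. -/
theorem isMatrixBasis_of_orthonormal {U : ι → E d → E m} {V : Submodule ℝ (L2 d m)}
    {F : ι × Fin m × Fin m → L2 d m}
    (hF : ∀ i a b, F (i, a, b) =ᵐ[volume] fun x => EuclideanSpace.single a (U i x b))
    (ho : Orthonormal ℝ F) (hs : closedSpan (Set.range F) = V) : IsMatrixBasis U V := by
  classical
  have hmem : ∀ i, MemLp (U i) 2 volume := fun i => by
    rw [memLp_piLp_iff]
    intro b
    refine ((Lp.memLp (F (i, b, b))).eval_piLp b).ae_eq ?_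
    filter_upwards [hF i b b] with x hx
    simp [hx]
  have hstar : ∀ i j a b, starProd (U i) (U j) a b = if (i, a) = (j, b) then 1 else 0 := by
    intro i j a b
    -- Both components are placed in the same position `a`, so that the inner product of the fields
    -- is the integral of their product.
    have h1 : starProd (U i) (U j) a b = ⟪F (i, a, a), F (j, a, b)⟫_ℝ := by
      rw [starProd, Matrix.of_apply, L2.inner_def]
      refine integral_congr_ae ?_
      filter_upwards [hF i a a, hF j a b] with x hx hx'
      rw [hx, hx', EuclideanSpace.inner_single_left]
      simp
    rw [h1, orthonormal_iff_ite.1 ho]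
    simp
  have hmul : ∀ Q i, matMul Q ((hmem i).toLp (U i)) =
      ∑ p : Fin m × Fin m, Q p.1 p.2 • F (i, p) := by
    intro Q i
    refine Lp.ext ?_
    have h1 : ∀ᵐ x : E d, ∀ p : Fin m × Fin m, (Q p.1 p.2 • F (i, p)) x =
        Q p.1 p.2 • EuclideanSpace.single p.1 (U i x p.2) := by
      refine ae_all_iff.2 fun p => ?_
      filter_upwards [Lp.coeFn_smul (Q p.1 p.2) (F (i, p)), hF i p.1 p.2] with x h2 h3
      rw [h2, Pi.smul_apply, h3]
    filter_upwards [ContinuousLinearMap.coeFn_compLp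
        (Matrix.toEuclideanCLM (n := Fin m) (𝕜 := ℝ) Q) ((hmem i).toLp (U i)),
      (hmem i).coeFn_toLp, h1, Lp.coeFn_finsetSum Finset.univ
        fun p : Fin m × Fin m => Q p.1 p.2 • F (i, p)] with x h2 h3 h4 h5
    rw [matMul, h2, h3, h5, Finset.sum_apply]
    simp only [h4, Fintype.sum_prod_type]
    ext a
    rw [Matrix.ofLp_toEuclideanCLM, Matrix.mulVec, dotProduct]
    simp only [WithLp.ofLp_sum, Finset.sum_apply, WithLp.ofLp_smul, Pi.smul_apply, PiLp.ofLp_single,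
      Pi.single_apply, smul_eq_mul, mul_ite, mul_zero]
    rw [Finset.sum_comm]
    simp
  refine ⟨hmem, fun i => ?_, fun i j hij => ?_, fun Q i => ?_, fun f hf => ?_⟩
  · ext a b
    simp [hstar, Matrix.one_apply]
  · ext a b
    simp [hstar, hij]
  · rw [hmul, ← hs]
    exact Submodule.sum_mem _ fun p _ => Submodule.smul_mem _ _ (subset_closedSpan _ ⟨_, rfl⟩)
  · refine ⟨fun i => Matrix.of fun a b => ⟪F (i, a, b), f⟫_ℝ, ⟨?_, ?_⟩, ?_⟩
    · have h := (ho.inner_products_summable f).prod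
      simpa [Fintype.sum_prod_type] using h
    · have h := (hasSum_of_mem_closedSpan ho (hs ▸ hf)).prod_fiberwise fun i => hasSum_fintype _
      simp only [hmul]
      exact h
    -- Pairing any expansion with `F (i, a, b)` recovers the entry `Q i a b`.
    · rintro Q ⟨-, hQ⟩
      ext i a b
      have h1 : HasSum (fun j => ⟪F (i, a, b), matMul (Q j) ((hmem j).toLp (U j))⟫_ℝ)
          ⟪F (i, a, b), f⟫_ℝ := hQ.mapL (innerSL ℝ (F (i, a, b)))
      have h2 : ∀ j, ⟪F (i, a, b), matMul (Q j) ((hmem j).toLp (U j))⟫_ℝ =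
          if j = i then Q i a b else 0 := by
        intro j
        rw [hmul, inner_sum]
        simp only [inner_smul_right, orthonormal_iff_ite.1 ho, Prod.mk.injEq]
        by_cases hji : j = i
        · subst hji
          rw [Finset.sum_eq_single (a, b)]
          · simp
          · rintro p - hp
            rw [if_neg fun h => hp h.2.symm, mul_zero]
          · simp
        · simp [hji, Ne.symm hji]
      simp only [h2] at h1
      exact (hasSum_ite_eq i (Q i a b)).unique h1

end MatrixBasis

/-! ### The tensor product multiresolution analysis -/

section TensorMRA

variable {d m : ℕ} {R : Fin d → Type} {W : Fin d → ℤ → Submodule ℝ L2R}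
  {B : ∀ i, Bool × R i × ℤ → L2R}

/-- The spaces of the tensor product multiresolution analysis of `L²(ℝᵈ, ℝᵐ)`. -/
def tensorMRA (m : ℕ) (W : Fin d → ℤ → Submodule ℝ L2R) (j : ℤ) : Submodule ℝ (L2 d m) :=
  tensorSpan (tensor d m) fun i => W i j

theorem isClosed_tensorMRA (j : ℤ) : IsClosed (tensorMRA m W j : Set (L2 d m)) :=
  isClosed_closedSpan _

theorem rescale_mem_tensorMRA {c : ℝ} (hc : 0 < c) (b : E d) {j j' : ℤ}
    (h : ∀ i, ∀ f ∈ W i j, rescale hc (b i) f ∈ W i j') {f : L2 d m} (hf : f ∈ tensorMRA m W j) :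
    rescale hc b f ∈ tensorMRA m W j' := by
  have hcl : IsClosed ((tensorMRA m W j').comap (rescale hc b).toLinearMap : Set (L2 d m)) :=
    (isClosed_tensorMRA j').preimage (rescale hc b).continuous
  refine tensorSpan_le (W := fun i => W i j) hcl (fun a g hg => ?_) hf
  change rescale hc b (tensor d m a g) ∈ tensorMRA m W j'
  rw [rescale_tensor]
  exact mem_tensorSpan a fun i => h i _ (hg i)

theorem rescale_two_mem_tensorMRA_iff (hB : ∀ i, IsMultiMRA (W i) (B i)) (j : ℤ) (f : L2 d m) :
    rescale two_pos 0 f ∈ tensorMRA m W (j + 1) ↔ f ∈ tensorMRA m W j := by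
  refine ⟨fun h => ?_, rescale_mem_tensorMRA _ _ fun i g hg => ((hB i).dilation j g).2 hg⟩
  have h2 : rescale (inv_pos.2 two_pos) (-((2 : ℝ)⁻¹ • (0 : E d))) (rescale two_pos 0 f) ∈
      tensorMRA m W j := by
    refine rescale_mem_tensorMRA _ _ (fun i g hg => ?_) h
    rw [← (hB i).dilation, rescale_rescale, rescale_congr _ one_pos (mul_inv_cancel₀ two_ne_zero) _,
      rescale_one_zero]
    · exact hg
    · simp
  rwa [rescale_inv_rescale] at h2

theorem rescale_intVec_mem_tensorMRA (hB : ∀ i, IsMultiMRA (W i) (B i)) (j : ℕ) (k : Fin d → ℤ)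
    {f : L2 d m} (hf : f ∈ tensorMRA m W j) :
    rescale one_pos (intVec k) f ∈ tensorMRA m W j := by
  refine rescale_mem_tensorMRA one_pos (intVec k) (fun i f hf => ?_) hf
  have h : intVec k i = (k i : ℝ) := rfl
  rw [h]
  exact (hB i).translation j (k i) f hf

theorem rescale_pow_mem_tensorMRA_iff (hB : ∀ i, IsMultiMRA (W i) (B i)) (j : ℕ) (k : ℤ)
    (f : L2 d m) :
    rescale (pow_pos two_pos j) 0 f ∈ tensorMRA m W (k + j) ↔ f ∈ tensorMRA m W k := by
  induction j with
  | zero => rw [rescale_congr _ one_pos (pow_zero 2) rfl, rescale_one_zero]; simp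
  | succ j ih =>
    have h := rescale_two_mem_tensorMRA_iff hB (k + j) (rescale (pow_pos two_pos j) 0 f)
    rw [ih, rescale_rescale, rescale_congr _ (pow_pos two_pos (j + 1)) (pow_succ' 2 j).symm _] at h
    · rwa [Nat.cast_succ, ← add_assoc]
    · simp

theorem dil_dyadic_pow (x : E d) (j : ℕ) : dil (dyadic d ^ j) x = (2 : ℝ) ^ j • x := by
  ext i
  simp [dil, dyadic, Matrix.diagonal_pow, Matrix.diagonal_map]

theorem isDilation_dyadic (d : ℕ) : IsDilation (dyadic d) := by
  intro μ hμ
  have : (dyadic d).map (Int.cast : ℤ → ℂ) = Matrix.diagonal fun _ => 2 := by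
    simp [dyadic, Matrix.diagonal_map]
  rw [this, spectrum_diagonal] at hμ
  obtain ⟨_, rfl⟩ := hμ
  simp

/-- The tensor products of the univariate functions `g i b r`, regrouped `m` at a time: the `r`-th
component of the field is the product over `i` of the functions `g i (ε i) (e (l, r) i)`. -/
def tensorGroup {ι : Type} (g : ∀ i, Bool → R i → ℝ → ℝ) (e : ι × Fin m ≃ ∀ i, R i)
    (ε : Fin d → Bool) (l : ι) : E d → E m :=
  fun x => WithLp.toLp 2 fun r => ∏ i, g i (ε i) (e (l, r) i) (x i)

variable {ι κ : Type} (e : ι × Fin m ≃ ∀ i, R i) (σ : κ ≃ NonzeroSign d × ι)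

/-- The index of the tensor product of univariate basis functions that stands in a given component
of a given multiple of a scaling function or a mother wavelet. -/
def tensorIndex :
    (((ι × (Fin d → ℤ)) × Fin m × Fin m) ⊕ ((κ × (Fin d → ℤ)) × Fin m × Fin m)) →
      Fin m × (∀ i, Bool × R i × ℤ) :=
  Sum.elim (fun p => (p.2.1, fun i => (false, e (p.1.1, p.2.2) i, p.1.2 i)))
    fun p => (p.2.1, fun i => ((σ p.1.1).1.1 i, e ((σ p.1.1).2, p.2.2) i, p.1.2 i))

/-- The vector of types is either zero, giving a scaling function, or nonzero, giving a wavelet; `e`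
recovers the block and the component from the indices in the factors, and the translations are read
off coordinatewise. -/
theorem tensorIndex_bijective : Function.Bijective (tensorIndex e σ) := by
  constructor
  · rintro (⟨⟨l, k⟩, a, b⟩ | ⟨⟨q, k⟩, a, b⟩) (⟨⟨l', k'⟩, a', b'⟩ | ⟨⟨q', k'⟩, a', b'⟩) h <;>
      simp only [tensorIndex, Sum.elim_inl, Sum.elim_inr, Prod.mk.injEq, funext_iff, forall_and,
        true_and] at h
    · obtain ⟨rfl, he, hk⟩ := h
      obtain rfl := funext hk
      have := e.injective (funext he)
      simp_all
    · exact absurd (funext fun i => (h.2.1 i).symm) (σ q').1.2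
    · exact absurd (funext h.2.1) (σ q).1.2
    · obtain ⟨rfl, hε, he, hk⟩ := h
      obtain rfl := funext hk
      have h1 := Prod.mk.inj (e.injective (funext he))
      have h2 : σ q = σ q' := Prod.ext (Subtype.ext (funext hε)) h1.1
      rw [σ.injective h2, h1.2]
  · rintro ⟨a, p⟩
    obtain ⟨⟨l, b⟩, hl⟩ := e.surjective fun i => (p i).2.1
    by_cases hε : (fun i => (p i).1) = fun _ => false
    · refine ⟨Sum.inl ((l, fun i => (p i).2.2), a, b), Prod.ext rfl (funext fun i => ?_)⟩
      simp only [tensorIndex, Sum.elim_inl, hl]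
      rw [← congrFun hε i]
    · refine ⟨Sum.inr ((σ.symm (⟨_, hε⟩, l), fun i => (p i).2.2), a, b),
        Prod.ext rfl (funext fun i => ?_)⟩
      simp [tensorIndex, hl]

/-- The tensor products of univariate basis functions, arranged into a basis of the space of scale
`1` of the tensor product multiresolution analysis. -/
def tensorBasis (B : ∀ i, Bool × R i × ℤ → L2R)
    (p : ((ι × (Fin d → ℤ)) × Fin m × Fin m) ⊕ ((κ × (Fin d → ℤ)) × Fin m × Fin m)) : L2 d m :=
  tensor d m (tensorIndex e σ p).1 fun i => B i ((tensorIndex e σ p).2 i)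

theorem orthonormal_tensorBasis (hB : ∀ i, IsMultiMRA (W i) (B i)) :
    Orthonormal ℝ (tensorBasis e σ B) :=
  ((isTensor_tensor d m).orthonormal fun i => (hB i).orthonormal).comp _
    (tensorIndex_bijective e σ).injective

theorem closedSpan_tensorBasis (hB : ∀ i, IsMultiMRA (W i) (B i)) :
    closedSpan (Set.range (tensorBasis e σ B)) = tensorMRA m W 1 := by
  rw [tensorMRA]
  simp only [← (hB _).span_one]
  rw [tensorSpan_closedSpan, ← (tensorIndex_bijective e σ).surjective.range_comp]
  rfl

theorem closedSpan_tensorBasis_inl (hB : ∀ i, IsMultiMRA (W i) (B i)) :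
    closedSpan (Set.range fun p => tensorBasis e σ B (Sum.inl p)) = tensorMRA m W 0 := by
  rw [tensorMRA]
  simp only [← (hB _).span_zero]
  rw [tensorSpan_closedSpan]
  congr 1
  refine le_antisymm ?_ ?_
  · rintro _ ⟨⟨⟨l, k⟩, a, b⟩, rfl⟩
    exact ⟨(a, fun i => (e (l, b) i, k i)), rfl⟩
  · rintro _ ⟨⟨a, p⟩, rfl⟩
    obtain ⟨⟨l, b⟩, hl⟩ := e.surjective fun i => (p i).1
    refine ⟨((l, fun i => (p i).2), a, b), ?_⟩
    simp only [tensorBasis, tensorIndex, Sum.elim_inl, hl]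

/-- Scale `0` is spanned by one part of an orthonormal basis of scale `1`, so the remaining part
spans the difference. -/
theorem closedSpan_tensorBasis_inr (hB : ∀ i, IsMultiMRA (W i) (B i)) :
    closedSpan (Set.range fun p => tensorBasis e σ B (Sum.inr p)) =
      (tensorMRA m W 0)ᗮ ⊓ tensorMRA m W 1 := by
  rw [closedSpan_inr_eq (orthonormal_tensorBasis e σ hB), closedSpan_tensorBasis_inl e σ hB,
    closedSpan_tensorBasis e σ hB]

theorem map_rescale_pow_tensorMRA (hB : ∀ i, IsMultiMRA (W i) (B i)) (j : ℕ) (k : ℤ) :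
    (tensorMRA m W k).map (rescaleEquiv (pow_pos two_pos j) 0).toLinearEquiv.toLinearMap =
      tensorMRA m W (k + j) := by
  ext f
  obtain ⟨f, rfl⟩ := (rescaleEquiv (pow_pos (two_pos (α := ℝ)) j) 0).surjective f
  rw [mem_map_iff, rescaleEquiv_apply, rescale_pow_mem_tensorMRA_iff hB]

/-- The unitary dilation by `2 ^ j` carries the difference of levels `1` and `0` onto that of levels
`j + 1` and `j`. -/
theorem closedSpan_rescale_tensorBasis (hB : ∀ i, IsMultiMRA (W i) (B i)) (j : ℕ) :
    closedSpan (Set.range fun p => rescaleEquiv (pow_pos two_pos j) 0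
      (tensorBasis e σ B (Sum.inr p))) = (tensorMRA m W j)ᗮ ⊓ tensorMRA m W (j + 1) := by
  have h := map_closedSpan (rescaleEquiv (pow_pos (two_pos (α := ℝ)) j) 0)
    (Set.range fun p => tensorBasis e σ B (Sum.inr p))
  rw [closedSpan_tensorBasis_inr e σ hB, map_inf_eq, map_orthogonal,
    map_rescale_pow_tensorMRA hB, map_rescale_pow_tensorMRA hB, ← Set.range_comp, zero_add,
    add_comm (1 : ℤ)] at h
  exact h.symm

variable {g : ∀ i, Bool → R i → ℝ → ℝ}

theorem coeFn_tensorBasis_inl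
    (hg : ∀ i b r (k : ℤ), B i (b, r, k) =ᵐ[volume] fun x => g i b r (x - k))
    (l : ι) (k : Fin d → ℤ) (a b : Fin m) :
    tensorBasis e σ B (Sum.inl ((l, k), a, b)) =ᵐ[volume] fun x =>
      EuclideanSpace.single a (translate (tensorGroup g e (fun _ => false) l) k x b) :=
  coeFn_tensor a fun i => hg i false (e (l, b) i) (k i)

theorem coeFn_tensorBasis_inr
    (hg : ∀ i b r (k : ℤ), B i (b, r, k) =ᵐ[volume] fun x => g i b r (x - k))
    (q : κ) (k : Fin d → ℤ) (a b : Fin m) :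
    tensorBasis e σ B (Sum.inr ((q, k), a, b)) =ᵐ[volume] fun x =>
      EuclideanSpace.single a (translate (tensorGroup g e (σ q).1.1 (σ q).2) k x b) :=
  coeFn_tensor a fun i => hg i ((σ q).1.1 i) (e ((σ q).2, b) i) (k i)

theorem isMatrixBasis_translate_scaling (hB : ∀ i, IsMultiMRA (W i) (B i))
    (hg : ∀ i b r (k : ℤ), B i (b, r, k) =ᵐ[volume] fun x => g i b r (x - k)) :
    IsMatrixBasis (fun p : ι × (Fin d → ℤ) => translate (tensorGroup g e (fun _ => false) p.1) p.2)
      (tensorMRA m W 0) :=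
  -- Only the scaling half of the basis is used, so any labelling of the wavelets serves.
  let σ := Equiv.refl (NonzeroSign d × ι)
  isMatrixBasis_of_orthonormal (F := fun p => tensorBasis e σ B (Sum.inl p))
    (by rintro ⟨l, k⟩ a b; exact coeFn_tensorBasis_inl e σ hg l k a b)
    ((orthonormal_tensorBasis e σ hB).comp _ Sum.inl_injective)
    (closedSpan_tensorBasis_inl e σ hB)

theorem isMatrixBasis_translate_wavelet (hB : ∀ i, IsMultiMRA (W i) (B i))
    (hg : ∀ i b r (k : ℤ), B i (b, r, k) =ᵐ[volume] fun x => g i b r (x - k)) :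
    IsMatrixBasis
      (fun p : κ × (Fin d → ℤ) => translate (tensorGroup g e (σ p.1).1.1 (σ p.1).2) p.2)
      ((tensorMRA m W 0)ᗮ ⊓ tensorMRA m W 1) :=
  isMatrixBasis_of_orthonormal (F := fun p => tensorBasis e σ B (Sum.inr p))
    (by rintro ⟨q, k⟩ a b; exact coeFn_tensorBasis_inr e σ hg q k a b)
    ((orthonormal_tensorBasis e σ hB).comp _ Sum.inr_injective)
    (closedSpan_tensorBasis_inr e σ hB)

theorem isVMRA_tensorMRA (hd : 1 ≤ d) (hB : ∀ i, IsMultiMRA (W i) (B i))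
    (hg : ∀ i b r (k : ℤ), B i (b, r, k) =ᵐ[volume] fun x => g i b r (x - k)) :
    IsVMRA (dyadic d) (tensorMRA m W) (tensorGroup g e fun _ => false) where
  isDilation := isDilation_dyadic d
  isClosed := isClosed_tensorMRA
  le_succ j := tensorSpan_mono fun i => (hB i).mono (by lia)
  iInf_eq :=
    have : Nonempty (Fin d) := ⟨⟨0, hd⟩⟩
    (isTensor_tensor d m).iInf_tensorSpan (isTotal_tensor d m) (fun i => (hB i).isClosed)
      (fun i => (hB i).mono) fun i => (hB i).iInf_eq
  dense := dense_iUnion_tensorSpan (isTotal_tensor d m) (fun i => (hB i).isClosed)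
      (fun i => (hB i).mono) fun i => (hB i).dense
  dilation j f g hfg := by
    have h : rescale two_pos 0 f = √(2 ^ d) • g := by
      refine Lp.ext ?_
      filter_upwards [coeFn_rescale two_pos 0 f, Lp.coeFn_smul (√(2 ^ d)) g, hfg] with x h1 h2 h3
      have h4 : dil (dyadic d) x = (2 : ℝ) • x := by simpa using dil_dyadic_pow x 1
      rw [h1, h2, Pi.smul_apply, h3, h4]
      simp
    rw [← rescale_two_mem_tensorMRA_iff hB, h, Submodule.smul_mem_iff _ (by positivity)]
  translation j k f g hj hfg := by
    lift j to ℕ using hj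
    have h : rescale one_pos (intVec k) f = g := by
      refine Lp.ext ?_
      filter_upwards [coeFn_rescale one_pos (intVec k) f, hfg] with x h1 h2
      rw [h1, h2]
      simp
    have h' : rescale one_pos (intVec (-k)) g = f := by
      rw [← h, rescale_rescale, rescale_congr _ one_pos (mul_one 1) _, rescale_one_zero]
      ext i
      simp [intVec]
    refine ⟨fun hf => ?_, fun hf => ?_⟩
    · rw [← h]
      exact rescale_intVec_mem_tensorMRA hB j k hf
    · rw [← h']
      exact rescale_intVec_mem_tensorMRA hB j (-k) hf
  basis := isMatrixBasis_translate_scaling e hB hg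

/-- The reordering of the indices of the scaling and wavelet basis functions. -/
def levelEquiv (α β γ δ : Type) : (α ⊕ β × ℕ × γ) × δ ≃ (α × δ) ⊕ ℕ × ((β × γ) × δ) where
  toFun
    | (Sum.inl a, m) => Sum.inl (a, m)
    | (Sum.inr (b, j, c), m) => Sum.inr (j, (b, c), m)
  invFun
    | Sum.inl (a, m) => (Sum.inl a, m)
    | Sum.inr (j, (b, c), m) => (Sum.inr (b, j, c), m)
  left_inv := by rintro ⟨_ | _, _⟩ <;> rfl
  right_inv := by rintro (_ | _) <;> rfl

theorem coeFn_rescale_tensorBasis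
    (hg : ∀ i b r (k : ℤ), B i (b, r, k) =ᵐ[volume] fun x => g i b r (x - k))
    (q : κ) (j : ℕ) (k : Fin d → ℤ) (a b : Fin m) :
    rescaleEquiv (pow_pos two_pos j) 0 (tensorBasis e σ B (Sum.inr ((q, k), a, b))) =ᵐ[volume]
      fun x => EuclideanSpace.single a
        (atom (dyadic d) (tensorGroup g e (σ q).1.1 (σ q).2) j k x b) := by
  filter_upwards [coeFn_rescale_of_ae_eq (pow_pos (two_pos (α := ℝ)) j) 0
    (coeFn_tensorBasis_inr e σ hg q k a b)] with x hx
  have h : √(((2 : ℝ) ^ j) ^ d) = √|((dyadic d).det : ℝ)| ^ j := by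
    rw [← pow_mul, mul_comm, pow_mul, dyadic, Matrix.det_diagonal]
    rw [Finset.prod_const, Finset.card_univ, Fintype.card_fin, Int.cast_pow, Int.cast_ofNat,
      abs_of_pos (by positivity)]
    simp [Real.sqrt_eq_rpow, ← Real.rpow_natCast, ← Real.rpow_mul, mul_assoc]
    ring_nf
  rw [rescaleEquiv_apply, hx, smul_single, atom, dil_dyadic_pow, finrank_euclideanSpace_fin, h]
  simp [translate]

/-- The regrouped tensor products of univariate multiresolution analyses give vector-valued wavelet
bases. -/
theorem isWaveletBasis_tensorGroup (hd : 1 ≤ d) (hB : ∀ i, IsMultiMRA (W i) (B i))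
    (hg : ∀ i b r (k : ℤ), B i (b, r, k) =ᵐ[volume] fun x => g i b r (x - k)) :
    IsWaveletBasis (dyadic d) (tensorGroup g e fun _ => false)
      fun q => tensorGroup g e (σ q).1.1 (σ q).2 := by
  have hV := isVMRA_tensorMRA (m := m) e hd hB hg
  have hmono : Monotone (tensorMRA m W) := monotone_int_of_le_succ hV.le_succ
  have ho := orthonormal_tensorBasis e σ hB
  refine ⟨tensorMRA m W, hV, isMatrixBasis_translate_wavelet e σ hB hg, ?_⟩
  · let b : ℕ → ((κ × (Fin d → ℤ)) × Fin m × Fin m) → L2 d m := fun j p =>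
      rescaleEquiv (pow_pos two_pos j) 0 (tensorBasis e σ B (Sum.inr p))
    have hb := closedSpan_rescale_tensorBasis e σ hB
    let F := Sum.elim (fun p => tensorBasis e σ B (Sum.inl p)) fun p : ℕ × _ => b p.1 p.2
    -- A matrix basis needs the component pair outside the choice between scaling functions and
    -- wavelets, whereas the level-by-level basis has it inside.
    let τ := levelEquiv (ι × (Fin d → ℤ)) κ (Fin d → ℤ) (Fin m × Fin m)
    refine isMatrixBasis_of_orthonormal (F := F ∘ τ) ?_ ?_ ?_
    · rintro (⟨l, k⟩ | ⟨q, j, k⟩) a b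
      · exact coeFn_tensorBasis_inl e σ hg l k a b
      · exact coeFn_rescale_tensorBasis e σ hg q j k a b
    · have h1 : ∀ p, tensorBasis e σ B (Sum.inl p) ∈ tensorMRA m W 0 := fun p =>
        closedSpan_tensorBasis_inl e σ hB ▸ subset_closedSpan _ ⟨p, rfl⟩
      have h2 : ∀ (j : ℕ) p, b j p ∈ (tensorMRA m W j)ᗮ ⊓ tensorMRA m W (j + 1) := fun j p =>
        hb j ▸ subset_closedSpan _ ⟨p, rfl⟩
      have h3 : ∀ j, Orthonormal ℝ (b j) := fun j =>
        (ho.comp _ Sum.inr_injective).comp_linearIsometryEquiv _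
      exact (orthonormal_sumElim_levels hmono (ho.comp _ Sum.inl_injective) h3 h1 h2).comp _
        τ.injective
    · rw [τ.surjective.range_comp]
      exact closedSpan_sumElim_levels hV.isClosed hmono hV.dense
        (closedSpan_tensorBasis_inl e σ hB) hb

end TensorMRA

/-! ### Regularity, supports and moments -/

section Properties

theorem contDiff_packet {n : ℕ} {k : ℕ∞} {f : ℝ → ℝ} (hf : ContDiff ℝ k f) (r : Fin n) :
    ContDiff ℝ k (packet n f r) :=
  contDiff_const.mul (hf.comp ((contDiff_const.mul contDiff_id).sub contDiff_const))

theorem hasCompactSupport_packet {n : ℕ} (hn : 0 < n) {f : ℝ → ℝ} (hf : HasCompactSupport f)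
    (r : Fin n) : HasCompactSupport (packet n f r) := by
  have hn' : (n : ℝ) ≠ 0 := by exact_mod_cast hn.ne'
  exact (hf.comp_homeomorph ((Homeomorph.mulLeft₀ (n : ℝ) hn').trans
    (Homeomorph.subRight (r : ℝ)))).mul_left (f := fun _ => √n)

theorem packet_mem_dilateSpan {n : ℕ} (hn : 0 < n) {S : Set (ℝ → ℝ)} {f : ℝ → ℝ} (hf : f ∈ S)
    (r : Fin n) : packet n f r ∈ dilateSpan S :=
  Submodule.smul_mem _ (√n) (Submodule.subset_span
    ⟨f, hf, n, r, by exact_mod_cast hn, rfl⟩)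

theorem integrable_comp_mul_sub {G : ℝ → ℝ} (hG : Integrable G) {c : ℝ} (hc : c ≠ 0) (b : ℝ) :
    Integrable fun x => G (c * x - b) :=
  (hG.comp_sub_right b).comp_mul_left' hc

theorem integral_comp_mul_sub (G : ℝ → ℝ) (c b : ℝ) :
    ∫ x, G (c * x - b) = |c⁻¹| • ∫ x, G x :=
  (Measure.integral_comp_mul_left (fun x => G (x - b)) c).trans
    (congrArg _ (integral_sub_right_eq_self G b))

/-- The function whose value at `n x - r` is `x ^ k` times `packet n f r x`. -/
def packetMoment (n : ℕ) (f : ℝ → ℝ) (r : Fin n) (k : ℕ) (y : ℝ) : ℝ :=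
  ∑ i ∈ Finset.range (k + 1),
    √n * ((n : ℝ)⁻¹ ^ k * ((r : ℝ) ^ (k - i) * k.choose i)) * (y ^ i * f y)

/-- With `y = n x - r` one has `x = n⁻¹ (y + r)`, and the binomial expansion expresses the moment
integrand through `y ^ i * f y` with `i ≤ k`. Vanishing of all lower moments is thus preserved. -/
theorem pow_mul_packet {n : ℕ} (hn : 0 < n) (f : ℝ → ℝ) (r : Fin n) (k : ℕ) (x : ℝ) :
    x ^ k * packet n f r x = packetMoment n f r k (n * x - r) := by
  have hn' : (n : ℝ) ≠ 0 := by exact_mod_cast hn.ne'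
  have h : x = (n : ℝ)⁻¹ * ((n * x - r) + r) := by field_simp; ring
  have h' : x ^ k = (n : ℝ)⁻¹ ^ k * ((n * x - r) + r) ^ k := by rw [← mul_pow, ← h]
  rw [h', packet, packetMoment, add_pow, Finset.mul_sum, Finset.sum_mul]
  exact Finset.sum_congr rfl fun i _ => by ring

theorem integrable_pow_mul_packet {n : ℕ} (hn : 0 < n) {f : ℝ → ℝ} {N : ℕ}
    (hf : ∀ k < N, Integrable fun x => x ^ k * f x) (r : Fin n) {k : ℕ} (hk : k < N) :
    Integrable fun x => x ^ k * packet n f r x := by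
  have hn' : (n : ℝ) ≠ 0 := by exact_mod_cast hn.ne'
  simp only [pow_mul_packet hn]
  have h : Integrable (packetMoment n f r k) := integrable_finsetSum _ fun i hi =>
    (hf i (by have := Finset.mem_range.1 hi; lia)).const_mul _
  exact integrable_comp_mul_sub h hn' (r : ℝ)

theorem vanishingMoments_packet {n : ℕ} (hn : 0 < n) {f : ℝ → ℝ} {N : ℕ}
    (hf : VanishingMoments N f) (r : Fin n) : VanishingMoments N (packet n f r) := by
  intro k hk
  refine ⟨integrable_pow_mul_packet hn (fun i hi => (hf i hi).1) r hk, ?_⟩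
  have hi : ∀ i ∈ Finset.range (k + 1), i < N := fun i hi => by
    have := Finset.mem_range.1 hi
    lia
  simp only [pow_mul_packet hn]
  rw [integral_comp_mul_sub]
  simp only [packetMoment]
  rw [integral_finsetSum _ fun i h => ((hf i (hi i h)).1).const_mul _,
    Finset.sum_eq_zero, smul_zero]
  intro i h
  rw [integral_const_mul, (hf i (hi i h)).2, mul_zero]

variable {d m : ℕ} {ι : Type} {R : Fin d → Type} {g : ∀ i, Bool → R i → ℝ → ℝ}

theorem contDiff_tensorGroup {k : ℕ∞} (hg : ∀ i b r, ContDiff ℝ k (g i b r))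
    (e : ι × Fin m ≃ ∀ i, R i) (ε : Fin d → Bool) (l : ι) : ContDiff ℝ k (tensorGroup g e ε l) := by
  refine contDiff_euclidean.2 fun r => ?_
  simp only [tensorGroup]
  refine contDiff_prod fun i _ => ?_
  exact (hg i _ _).comp (contDiff_piLp_apply 2 (i := i))

theorem hasCompactSupport_tensorGroup (hg : ∀ i b r, HasCompactSupport (g i b r))
    (e : ι × Fin m ≃ ∀ i, R i) (ε : Fin d → Bool) (l : ι) :
    HasCompactSupport (tensorGroup g e ε l) := by
  refine HasCompactSupport.intro (K := ⋃ r : Fin m, (PiLp.homeomorph 2 fun _ : Fin d => ℝ) ⁻¹'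
    Set.pi Set.univ fun i => tsupport (g i (ε i) (e (l, r) i))) ?_ fun x hx => ?_
  · exact isCompact_iUnion fun r => (Homeomorph.isCompact_preimage _).2
      (isCompact_univ_pi fun i => hg i _ _)
  · ext r
    have hr : ∃ i, x i ∉ tsupport (g i (ε i) (e (l, r) i)) := by
      by_contra! h
      exact hx (Set.mem_iUnion.2 ⟨r, fun i _ => h i⟩)
    obtain ⟨i, hi⟩ := hr
    exact Finset.prod_eq_zero (Finset.mem_univ i) (image_eq_zero_of_notMem_tsupport hi)

/-- The integral factors over the coordinates. A nonzero type has a coordinate with a wavelet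
factor, and there the exponent is at most the total degree, hence below `N`. -/
theorem vanishingMomentsVec_tensorGroup {N : ℕ}
    (hg : ∀ i b r, ∀ k < N, Integrable fun x => x ^ k * g i b r x)
    (hg' : ∀ i r, VanishingMoments N (g i true r))
    (e : ι × Fin m ≃ ∀ i, R i) (ε : NonzeroSign d) (l : ι) :
    VanishingMomentsVec N (tensorGroup g e ε.1 l) := by
  intro β hβ
  have hβi : ∀ i, β i < N := fun i =>
    (Finset.single_le_sum (fun _ _ => Nat.zero_le _) (Finset.mem_univ i)).trans_lt hβ
  have hcomp : ∀ r (x : E d), ((∏ i, x i ^ β i) • tensorGroup g e ε.1 l x) r =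
      ∏ i, (x i ^ β i * g i (ε.1 i) (e (l, r) i) (x i)) := fun r x => by
    simp [tensorGroup, Finset.prod_mul_distrib]
  have hint : ∀ r, Integrable fun x : E d => ((∏ i, x i ^ β i) • tensorGroup g e ε.1 l x) r := by
    intro r
    simp only [hcomp]
    exact integrable_prod_coord (f := fun i t => t ^ β i * g i (ε.1 i) (e (l, r) i) t)
      fun i => hg i _ _ _ (hβi i)
  refine ⟨integrable_piLp_iff.2 hint, ?_⟩
  ext r
  rw [eval_integral_piLp hint]
  simp only [hcomp]
  rw [integral_prod_coord fun i t => t ^ β i * g i (ε.1 i) (e (l, r) i) t]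
  obtain ⟨i, hi⟩ : ∃ i, ε.1 i = true := by
    by_contra! h
    exact ε.2 (funext fun i => by simpa using h i)
  refine Finset.prod_eq_zero (Finset.mem_univ i) ?_
  rw [hi]
  exact (hg' i _ _ (hβi i)).2

/-- The regrouped tensor products of the functions `√n φ(n · - r)`, `√n ψ(n · - r)`, where `n` may
depend on the coordinate, give vector-valued wavelet bases that inherit the properties of `φ` and
`ψ`. -/
theorem isWaveletBasis_packet {φ ψ : ℝ → ℝ} (h : IsScalarWavelet φ ψ) (hd : 1 ≤ d) {κ : Type}
    (n : Fin d → ℕ) (hn : ∀ i, 0 < n i) (e : ι × Fin m ≃ ∀ i, Fin (n i))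
    (σ : κ ≃ NonzeroSign d × ι) :
    let g : ∀ i, Bool → Fin (n i) → ℝ → ℝ := fun i b => packet (n i) (if b = true then ψ else φ)
    IsWaveletBasis (dyadic d) (tensorGroup g e fun _ => false)
        (fun q => tensorGroup g e (σ q).1.1 (σ q).2) ∧
      Inherits φ ψ (tensorGroup g e fun _ => false)
        fun q => tensorGroup g e (σ q).1.1 (σ q).2 := by
  intro g
  choose W B hB hg using fun i => exists_isMultiMRA_packet h (hn i)
  refine ⟨isWaveletBasis_tensorGroup e σ hd hB hg, ⟨fun k hφ hψ => ?_, fun hφ hψ => ?_,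
    fun N hφ hψ q => ?_⟩⟩
  · have : ∀ i b r, ContDiff ℝ k (g i b r) := fun i b r =>
      contDiff_packet (by split_ifs <;> assumption) r
    exact ⟨fun l => contDiff_tensorGroup this e _ l, fun q => contDiff_tensorGroup this e _ _⟩
  · have : ∀ i b r, HasCompactSupport (g i b r) := fun i b r =>
      hasCompactSupport_packet (hn i) (by split_ifs <;> assumption) r
    exact ⟨fun l => hasCompactSupport_tensorGroup this e _ l,
      fun q => hasCompactSupport_tensorGroup this e _ _⟩
  · refine vanishingMomentsVec_tensorGroup (fun i b r k hk => ?_)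
      (fun i r => vanishingMoments_packet (hn i) hψ r) e (σ q).1 (σ q).2
    refine integrable_pow_mul_packet (hn i) (fun k hk => ?_) r hk
    split_ifs
    · exact (hψ k hk).1
    · exact hφ k hk

end Properties

/-- In dimension one there is only one type of mother wavelets. -/
def unitEquivNonzeroSign : Unit ≃ NonzeroSign 1 × Unit where
  toFun _ := (⟨fun _ => true, fun h => by simpa using congrFun h 0⟩, ())
  invFun _ := ()
  left_inv _ := rfl
  right_inv := by
    rintro ⟨⟨ε, hε⟩, _⟩
    refine Prod.ext (Subtype.ext (funext fun i => ?_)) rfl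
    by_contra h
    refine hε (funext fun j => ?_)
    rw [Subsingleton.elim j i]
    simpa using Ne.symm h

end VecWavelet

end

/-! ### The theorem: two choices of packet sizes -/

theorem theorem5p1 (φ ψ : ℝ → ℝ) (h : VecWavelet.IsScalarWavelet φ ψ)
    (d m : ℕ) (hd : 1 ≤ d) (hm : 1 ≤ m) :
    (∃ (Φ : VecWavelet.E d → VecWavelet.E m)
        (Ψ : VecWavelet.NonzeroSign d → VecWavelet.E d → VecWavelet.E m),
      VecWavelet.IsWaveletBasis (VecWavelet.dyadic d) (fun _ : Unit => Φ) Ψ ∧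
      VecWavelet.IsSeparable φ ψ Φ ∧ (∀ ε, VecWavelet.IsSeparable φ ψ (Ψ ε)) ∧
      VecWavelet.Inherits φ ψ (fun _ : Unit => Φ) Ψ) ∧
    (∃ u w : Fin m → ℝ → ℝ,
      (∀ r, u r ∈ VecWavelet.dilateSpan {φ, ψ}) ∧ (∀ r, w r ∈ VecWavelet.dilateSpan {ψ}) ∧
      VecWavelet.IsWaveletBasis (VecWavelet.dyadic 1)
        (fun _ : Unit => VecWavelet.vec u) (fun _ : Unit => VecWavelet.vec w) ∧
      VecWavelet.Inherits φ ψ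
        (fun _ : Unit => VecWavelet.vec u) (fun _ : Unit => VecWavelet.vec w) ∧
      ∀ e : Fin (m ^ (d - 1)) × Fin m ≃ (Fin d → Fin m),
        VecWavelet.IsWaveletBasis (VecWavelet.dyadic d)
          (fun l => VecWavelet.regroup u w e (fun _ => false) l)
          (fun q : VecWavelet.NonzeroSign d × Fin (m ^ (d - 1)) =>
            VecWavelet.regroup u w e q.1.1 q.2) ∧
        VecWavelet.Inherits φ ψ
          (fun l => VecWavelet.regroup u w e (fun _ => false) l)
          (fun q : VecWavelet.NonzeroSign d × Fin (m ^ (d - 1)) =>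
            VecWavelet.regroup u w e q.1.1 q.2)) := by
  open VecWavelet in
  refine ⟨?_, packet m φ, packet m ψ, fun r => packet_mem_dilateSpan hm (by simp) r,
    fun r => packet_mem_dilateSpan hm (by simp) r, ?_⟩
  -- Splitting only the first coordinate into `m` functions yields exactly `m` scaling products,
  -- which form one block; their order is immaterial, so `e` below is an arbitrary bijection.
  · let n : Fin d → ℕ := Function.update (fun _ => 1) ⟨0, hd⟩ m
    have hn : ∀ i, 0 < n i := fun i => by
      by_cases hi : i = ⟨0, hd⟩
      · subst hi; simpa [n] using Nat.lt_of_succ_le hm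
      · simp [n, hi]
    have hcard : Fintype.card (Unit × Fin m) = Fintype.card (∀ i, Fin (n i)) := by
      simp [n, Finset.prod_update_of_mem]
    let g : ∀ i, Bool → Fin (n i) → ℝ → ℝ := fun i b => packet (n i) (if b = true then ψ else φ)
    let e := Fintype.equivOfCardEq hcard
    have hsep : ∀ ε, IsSeparable φ ψ (tensorGroup g e ε ()) := fun ε r =>
      ⟨_, fun i => packet_mem_dilateSpan (hn i) (by split_ifs <;> simp) (e ((), r) i),
        fun _ => rfl⟩
    have H := isWaveletBasis_packet h hd n hn e (Equiv.prodPUnit (NonzeroSign d)).symm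
    exact ⟨tensorGroup g e (fun _ => false) (), fun ε => tensorGroup g e ε.1 (), H.1, hsep _,
      fun ε => hsep ε.1, H.2⟩
  -- In dimension one the `m` packet functions form a single block, which gives `u` and `w`
  -- themselves.
  · have h1 := isWaveletBasis_packet h le_rfl (fun _ : Fin 1 => m) (fun _ => hm)
      ((Equiv.punitProd (Fin m)).trans (Equiv.funUnique (Fin 1) (Fin m)).symm) unitEquivNonzeroSign
    have hvec : ∀ (f : ℝ → ℝ) (b : Bool), (if b = true then ψ else φ) = f →
        tensorGroup (R := fun _ : Fin 1 => Fin m)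
          (fun _ b => packet m (if b = true then ψ else φ))
          ((Equiv.punitProd (Fin m)).trans (Equiv.funUnique (Fin 1) (Fin m)).symm)
          (fun _ => b) () = vec (packet m f) := by
      intro f b hb
      ext x r
      simp [tensorGroup, vec, hb]
    have hu : tensorGroup (R := fun _ : Fin 1 => Fin m)
          (fun _ b => packet m (if b = true then ψ else φ))
          ((Equiv.punitProd (Fin m)).trans (Equiv.funUnique (Fin 1) (Fin m)).symm)
          (fun _ => false) = fun _ => vec (packet m φ) := funext fun _ => hvec φ false rfl
    have hw : (fun q => tensorGroup (R := fun _ : Fin 1 => Fin m)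
          (fun _ b => packet m (if b = true then ψ else φ))
          ((Equiv.punitProd (Fin m)).trans (Equiv.funUnique (Fin 1) (Fin m)).symm)
          (unitEquivNonzeroSign q).1.1 (unitEquivNonzeroSign q).2) =
        fun _ => vec (packet m ψ) := funext fun _ => hvec ψ true rfl
    have h1' := h1.2
    have h1 := h1.1
    rw [hu, hw] at h1 h1'
    refine ⟨h1, h1', fun e => ?_⟩
    -- Each coordinate now carries the same `m` functions, and the prescribed partition is the
    -- grouping `e`.
    have h2 := isWaveletBasis_packet h hd (fun _ => m) (fun _ => hm) e (Equiv.refl _)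
    have hg : ∀ ε l, tensorGroup (R := fun _ : Fin d => Fin m)
        (fun _ b => packet m (if b = true then ψ else φ)) e ε l =
        regroup (packet m φ) (packet m ψ) e ε l := by
      intro ε l
      ext x r
      simp only [tensorGroup, regroup]
      refine Finset.prod_congr rfl fun i _ => ?_
      split_ifs <;> rfl
    simp only [← hg]
    exact h2
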